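/- **Conventions.** All identities are identities between formal operator power series, multiplied termwise by the indicated commutation rules. Two series are equal if they have the same leading term and if all their coefficients coincide as meromorphic functions of two complex variables (i.e. agree on a dense open subset of $\mathbb C^2$). $(x)_k=x(x+1)\cdots(x+k-1)$, $\partial_j=\partial/\partial z_j$. **(o) No deformation.** Operators are series $\sum_{n\ge 0} z_1^{\alpha_1+n}z_2^{\alpha_2-n}c_n(z_1\partial_1,z_2\partial_2)$, with $f(z_1\partial_1,z_2\partial_2)\,z_1^{\beta_1}z_2^{\beta_2}=z_1^{\beta_1}z_2^{\beta_2}f(z_1\partial_1+\beta_1,z_2\partial_2+\beta_2)$. For $a\in\mathbb C$, $$\mathcal S_1(a)=z_1^{-a}\frac{\Gamma(z_1\partial_1+1)}{\Gamma(z_1\partial_1+1-a)},\quad \mathcal S_3(a)=z_2^{-a}\frac{\Gamma(z_2\partial_2+1)}{\Gamma(z_2\partial_2+1-a)},\quad \mathcal S_2(a)=(z_2-z_1)^a=z_2^a\sum_{k\ge0}\frac{(-a)_k}{k!}\Big(\frac{z_1}{z_2}\Big)^k .$$ **(q) Quantum deformation.** Let $q=e^h$ with $\operatorname{Re}h<0$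 (so $0<|q|<1$), $q^w=e^{wh}$, $(x;q^2)=\prod_{k\ge0}(1-xq^{2k})$. Use logarithmic coordinates $z_j=q^{x_j}$, so that $z_j^a=q^{ax_j}$ and $q^{\beta z_j\partial_j}$ is the shift $x_j\mapsto x_j+\beta$. Operators are series $\sum_{m,n\ge0}c_{mn}(x_1,x_2)\,q^{(\alpha_1+2m)z_1\partial_1+(\alpha_2+2n)z_2\partial_2}$. For $a\in\mathbb C$, $$\mathcal S_1(a)=\frac{q^{a^2/2}}{z_1^a}\,\frac{(q^{2-2a+2z_1\partial_1};q^2)}{(q^{2+2z_1\partial_1};q^2)}\,q^{-az_1\partial_1},\qquad \mathcal S_2(a)=z_1^a\,\frac{(\frac{z_2}{z_1}q^{1-a};q^2)}{(\frac{z_2}{z_1}q^{1+a};q^2)},$$ where the quotient in $\mathcal S_1(a)$ is expanded in powers of $q^{2z_1\partial_1}$, and $\mathcal S_3(a)$ is $\mathcal S_1(a)$ with $z_1$ replaced by $z_2$. **(e) Elliptic deformation.** Let $\operatorname{Im}\tau>0$, $\operatorname{Im}\eta>0$, $$\theta_1(z|\tau)=\sum_{n\in\mathbb Z}e^{\pi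 i(n+\frac12)^2\tau+2\pi i(n+\frac12)(z+\frac12)},\qquad \gamma(x)=\Gamma(\eta x|\tau,2\eta),\qquad \Gamma(z|\tau,\tau')=\prod_{n,m\ge0}\frac{1-e^{2\pi i(\tau(n+1)+\tau'(m+1)-z)}}{1-e^{2\pi i(\tau n+\tau' m+z)}},$$ $[x]=\theta_1(2\eta x|\tau)$, $[x]_k=[x][x+1]\cdots[x+k-1]$ with $[x]_0=1$, $[k]!=[1]_k$, and assume that $[k]\ne0$ for all integers $k\ge1$. Operators are series $\sum_{m,n\ge0}c_{mn}(z_1,z_2)\,e^{(\alpha_1-2m)\partial_1+(\alpha_2-2n)\partial_2}$, where $e^{\beta\partial_j}$ is the shift $z_j\mapsto z_j+\beta$. For $a\in\mathbb C$, $$\mathcal S_1(a)=\frac{e^{2\pi i a\eta z_1+\pi i\eta a^2}\gamma(2z_1)}{\gamma(2z_1+2a)}\sum_{k=0}^\infty\frac{[-z_1-a+2k]\,[-z_1-a]_k\,[-a]_k}{[-z_1-a]\,[-z_1+1]_k\,[k]!}\,e^{(a-2k)\partial_1},$$ $$\mathcal S_2(a)=e^{-2\pi i a\eta z_1}\frac{\gamma(z_1+z_2+1+a)}{\gamma(z_1+z_2+1-a)}\,\frac{\gamma(z_1-z_2+1+a)}{\gamma(z_1-z_2+1-a)},$$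 and $\mathcal S_3(a)$ is $\mathcal S_1(a)$ with $z_1$ replaced by $z_2$. **Theorem.** In each of the three cases, for all $a,b\in\mathbb C$, $$\mathcal S_i(-a)\,\mathcal S_i(a)=1\quad(i=1,2,3),\qquad \mathcal S_1(a)\,\mathcal S_3(b)=\mathcal S_3(b)\,\mathcal S_1(a),$$ $$\mathcal S_1(a)\,\mathcal S_2(a+b)\,\mathcal S_1(b)=\mathcal S_2(b)\,\mathcal S_1(a+b)\,\mathcal S_2(a),\qquad \mathcal S_2(a)\,\mathcal S_3(a+b)\,\mathcal S_2(b)=\mathcal S_3(b)\,\mathcal S_2(a+b)\,\mathcal S_3(a).$$ -/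

import Mathlib

noncomputable section

namespace ParamPerm

open Complex

/-! ### Meromorphic coefficients -/

/-- Equality of two functions of two complex variables as meromorphic functions: they agree on a
dense open subset of `ℂ × ℂ` (so that the values which a formula takes at its singularities
play no role). -/
def MerEq (f g : ℂ × ℂ → ℂ) : Prop :=
  ∃ U : Set (ℂ × ℂ), IsOpen U ∧ Dense U ∧ Set.EqOn f g U

theorem MerEq.refl (f : ℂ × ℂ → ℂ) : MerEq f f :=
  ⟨Set.univ, isOpen_univ, dense_univ, fun _ _ => rfl⟩

theorem MerEq.symm {f g : ℂ × ℂ → ℂ} : MerEq f g → MerEq g f :=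
  fun ⟨U, hU, hd, h⟩ => ⟨U, hU, hd, h.symm⟩

theorem MerEq.trans {f g k : ℂ × ℂ → ℂ} : MerEq f g → MerEq g k → MerEq f k :=
  fun ⟨U, hU, hd, h⟩ ⟨V, hV, hd', h'⟩ =>
    ⟨U ∩ V, hU.inter hV, hd.inter_of_isOpen_left hd' hU,
      fun _ hx => (h hx.1).trans (h' hx.2)⟩

/-- The `k`-th Taylor coefficient at `0` of a function of one complex variable. -/
def taylorCoeff (f : ℂ → ℂ) (k : ℕ) : ℂ := iteratedDeriv k f 0 / (k.factorial : ℂ)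

/-! ### Power series in shift operators -/

/-- A formal operator power series in translation operators of two complex variables
`x = (x₁, x₂)`, with step `s`:
`∑_{m,n ≥ 0} coeff m n (x) · T^(lead + (s m, s n))`, where `(T^β f)(x) = f (x + β)`,
that is `T^β = exp (β₁ ∂₁ + β₂ ∂₂)`. -/
structure ShiftSeries (s : ℂ) where
  lead : ℂ × ℂ
  coeff : ℕ → ℕ → ℂ × ℂ → ℂ

namespace ShiftSeries

variable {s : ℂ}

/-- The operator of multiplication by the function `f`. -/
def multiplication (f : ℂ × ℂ → ℂ) : ShiftSeries s where
  lead := 0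
  coeff m n x := if m = 0 ∧ n = 0 then f x else 0

/-- The series `∑ₖ c k (x₁) exp ((α + s k) ∂₁)`. -/
def inFirst (α : ℂ) (c : ℕ → ℂ → ℂ) : ShiftSeries s where
  lead := (α, 0)
  coeff m n x := if n = 0 then c m x.1 else 0

/-- The series `∑ₖ c k (x₂) exp ((α + s k) ∂₂)`. -/
def inSecond (α : ℂ) (c : ℕ → ℂ → ℂ) : ShiftSeries s where
  lead := (0, α)
  coeff m n x := if m = 0 then c n x.2 else 0

instance : One (ShiftSeries s) := ⟨multiplication fun _ => 1⟩

/-- The operator product, determined by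
`(f(x) T^α) (g(x) T^β) = f(x) g(x + α) T^(α + β)`. -/
instance : Mul (ShiftSeries s) where
  mul A B :=
    { lead := A.lead + B.lead
      coeff := fun m n x =>
        ∑ p ∈ Finset.HasAntidiagonal.antidiagonal m, ∑ r ∈ Finset.HasAntidiagonal.antidiagonal n,
          A.coeff p.1 r.1 x *
            B.coeff p.2 r.2 (x + A.lead + (s * (p.1 : ℂ), s * (r.1 : ℂ))) }

/-- Equality of operator power series: the same leading shift, and coefficients that are equal as
meromorphic functions. -/
instance : Setoid (ShiftSeries s) where
  r A B := A.lead = B.lead ∧ ∀ m n, MerEq (A.coeff m n) (B.coeff m n)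
  iseqv :=
    { refl := fun _ => ⟨rfl, fun _ _ => MerEq.refl _⟩
      symm := fun h => ⟨h.1.symm, fun m n => (h.2 m n).symm⟩
      trans := fun h h' => ⟨h.1.trans h'.1, fun m n => (h.2 m n).trans (h'.2 m n)⟩ }

end ShiftSeries

/-! ### Power series in `z₁ / z₂` with coefficients depending on `z₁∂₁`, `z₂∂₂` -/

/-- A formal operator power series in `z₁ / z₂`,
`∑_{n ≥ 0} z₁^(lead₁ + n) z₂^(lead₂ - n) · coeff n (z₁∂₁, z₂∂₂)`.
On a monomial it acts by
`z₁^d₁ z₂^d₂ ↦ ∑ₙ coeff n (d₁, d₂) z₁^(d₁ + lead₁ + n) z₂^(d₂ + lead₂ - n)`. -/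
structure EulerSeries where
  lead : ℂ × ℂ
  coeff : ℕ → ℂ × ℂ → ℂ

namespace EulerSeries

/-- The operator `z₁^α₁ z₂^α₂ f(z₁∂₁, z₂∂₂)`. -/
def single (α : ℂ × ℂ) (f : ℂ × ℂ → ℂ) : EulerSeries where
  lead := α
  coeff n d := if n = 0 then f d else 0

instance : One EulerSeries := ⟨single 0 fun _ => 1⟩

/-- The operator product (composition of the actions on monomials), determined by
`f(z₁∂₁, z₂∂₂) z₁^β₁ z₂^β₂ = z₁^β₁ z₂^β₂ f(z₁∂₁ + β₁, z₂∂₂ + β₂)`. -/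
instance : Mul EulerSeries where
  mul A B :=
    { lead := A.lead + B.lead
      coeff := fun n d =>
        ∑ p ∈ Finset.HasAntidiagonal.antidiagonal n,
          A.coeff p.1 (d + B.lead + ((p.2 : ℂ), -(p.2 : ℂ))) * B.coeff p.2 d }

/-- Equality of operator power series: the same leading monomial, and coefficients that are equal
as meromorphic functions of `d₁ = z₁∂₁`, `d₂ = z₂∂₂`. -/
instance : Setoid EulerSeries where
  r A B := A.lead = B.lead ∧ ∀ n, MerEq (A.coeff n) (B.coeff n)
  iseqv :=
    { refl := fun _ => ⟨rfl, fun _ => MerEq.refl _⟩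
      symm := fun h => ⟨h.1.symm, fun n => (h.2 n).symm⟩
      trans := fun h h' => ⟨h.1.trans h'.1, fun n => (h.2 n).trans (h'.2 n)⟩ }

end EulerSeries

/-! ### The Coxeter relations -/

/-- The Coxeter relations of `𝔖₄` for three one-parameter families of operators. -/
def CoxeterRelations {Op : Type} [Mul Op] [One Op] [Setoid Op] (S₁ S₂ S₃ : ℂ → Op) : Prop :=
  (∀ a, S₁ (-a) * S₁ a ≈ 1) ∧ (∀ a, S₂ (-a) * S₂ a ≈ 1) ∧ (∀ a, S₃ (-a) * S₃ a ≈ 1) ∧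
  (∀ a b, S₁ a * S₃ b ≈ S₃ b * S₁ a) ∧
  (∀ a b, S₁ a * S₂ (a + b) * S₁ b ≈ S₂ b * S₁ (a + b) * S₂ a) ∧
  (∀ a b, S₂ a * S₃ (a + b) * S₂ b ≈ S₃ b * S₂ (a + b) * S₃ a)

/-! ### No deformation -/

namespace Undeformed

/-- `Γ(d + 1) / Γ(d + 1 - a)`. -/
def gammaRatio (a d : ℂ) : ℂ := Gamma (d + 1) / Gamma (d + 1 - a)

/-- `S₁(a) = z₁^(-a) Γ(z₁∂₁ + 1) / Γ(z₁∂₁ + 1 - a)`. -/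
def S₁ (a : ℂ) : EulerSeries := .single (-a, 0) fun d => gammaRatio a d.1

/-- `S₂(a) = (z₂ - z₁)^a = z₂^a (1 - z₁/z₂)^a`, expanded in powers of `z₁ / z₂`. -/
def S₂ (a : ℂ) : EulerSeries where
  lead := (0, a)
  coeff n _ := taylorCoeff (fun t => (1 - t) ^ a) n

/-- `S₃(a) = z₂^(-a) Γ(z₂∂₂ + 1) / Γ(z₂∂₂ + 1 - a)`. -/
def S₃ (a : ℂ) : EulerSeries := .single (0, -a) fun d => gammaRatio a d.2

end Undeformed

/-! ### Quantum deformation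

Here `q = exp h`. The variables are the logarithmic coordinates `x₁, x₂` with `zⱼ = q^(xⱼ)`, so
that `zⱼ^a = q^(a xⱼ)` and `q^(β zⱼ∂ⱼ)` is the translation `xⱼ ↦ xⱼ + β`. -/

namespace Quantum

/-- `q^w` for `q = exp h`. -/
def qpow (h w : ℂ) : ℂ := exp (w * h)

/-- `(x; q²) = ∏_{k ≥ 0} (1 - x q^(2k))`. -/
def qProd (h x : ℂ) : ℂ := ∏' k : ℕ, (1 - x * qpow h (2 * (k : ℂ)))

/-- `w ↦ (q^(2-2a) w; q²) / (q² w; q²)`. -/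
def qRatio (h a w : ℂ) : ℂ := qProd h (qpow h (2 - 2 * a) * w) / qProd h (qpow h 2 * w)

/-- The coefficients of the operator
`q^(a²/2) z^(-a) · (q^(2-2a+2z∂); q²) / (q^(2+2z∂); q²) · q^(-a z∂)`,
expanded in powers of `q^(2z∂)`, at `z = q^x`: the operator is
`∑ₖ intertwinerCoeff h a k x · q^((-a + 2k) z∂)`. -/
def intertwinerCoeff (h a : ℂ) (k : ℕ) (x : ℂ) : ℂ :=
  qpow h (a ^ 2 / 2) * qpow h (-a * x) * taylorCoeff (qRatio h a) k

def S₁ (h a : ℂ) : ShiftSeries 2 := .inFirst (-a) (intertwinerCoeff h a)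

/-- `S₂(a) = z₁^a (q^(1-a) z₂/z₁; q²) / (q^(1+a) z₂/z₁; q²)`. -/
def S₂ (h a : ℂ) : ShiftSeries 2 := .multiplication fun x =>
  qpow h (a * x.1) *
    (qProd h (qpow h (x.2 - x.1) * qpow h (1 - a)) /
      qProd h (qpow h (x.2 - x.1) * qpow h (1 + a)))

def S₃ (h a : ℂ) : ShiftSeries 2 := .inSecond (-a) (intertwinerCoeff h a)

end Quantum

/-! ### Elliptic deformation -/

namespace Elliptic

/-- `θ₁(z | τ)`. -/
def theta₁ (τ z : ℂ) : ℂ :=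
  ∑' n : ℤ, exp (Real.pi * I * ((n : ℂ) + 1 / 2) ^ 2 * τ) *
    exp (2 * Real.pi * I * ((n : ℂ) + 1 / 2) * (z + 1 / 2))

/-- The elliptic gamma function
`Γ(z | τ, τ') = ∏_{n,m ≥ 0} (1 - e^(2πi(τ(n+1) + τ'(m+1) - z))) / (1 - e^(2πi(τn + τ'm + z)))`. -/
def ellGamma (τ τ' z : ℂ) : ℂ :=
  (∏' p : ℕ × ℕ,
      (1 - exp (2 * Real.pi * I * (τ * ((p.1 : ℂ) + 1) + τ' * ((p.2 : ℂ) + 1) - z)))) /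
    ∏' p : ℕ × ℕ, (1 - exp (2 * Real.pi * I * (τ * (p.1 : ℂ) + τ' * (p.2 : ℂ) + z)))

/-- `γ(x) = Γ(η x | τ, 2η)`. -/
def gam (τ η x : ℂ) : ℂ := ellGamma τ (2 * η) (η * x)

/-- The elliptic number `[x] = θ₁(2ηx | τ)`. -/
def ellNum (τ η x : ℂ) : ℂ := theta₁ τ (2 * η * x)

/-- The shifted elliptic factorial `[x]_k = [x][x+1]⋯[x+k-1]`; in particular `[1]_k = [k]!`. -/
def ellPoch (τ η x : ℂ) (k : ℕ) : ℂ := ∏ j ∈ Finset.range k, ellNum τ η (x + (j : ℂ))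

/-- The coefficient of `e^((a-2k)∂)` in the elliptic intertwining operator:
`e^(2πiaηz + πiηa²) γ(2z)/γ(2z+2a) · [-z-a+2k][-z-a]_k[-a]_k / ([-z-a][-z+1]_k[k]!)`. -/
def intertwinerCoeff (τ η a : ℂ) (k : ℕ) (z : ℂ) : ℂ :=
  exp (2 * Real.pi * I * a * η * z + Real.pi * I * η * a ^ 2) *
    (gam τ η (2 * z) / gam τ η (2 * z + 2 * a)) *
    (ellNum τ η (-z - a + 2 * (k : ℂ)) * ellPoch τ η (-z - a) k * ellPoch τ η (-a) k /
      (ellNum τ η (-z - a) * ellPoch τ η (-z + 1) k * ellPoch τ η 1 k))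

def S₁ (τ η a : ℂ) : ShiftSeries (-2) := .inFirst a (intertwinerCoeff τ η a)

/-- Multiplication by
`e^(-2πiaηz₁) γ(z₁+z₂+1+a)/γ(z₁+z₂+1-a) · γ(z₁-z₂+1+a)/γ(z₁-z₂+1-a)`. -/
def S₂ (τ η a : ℂ) : ShiftSeries (-2) := .multiplication fun z =>
  exp (-2 * Real.pi * I * a * η * z.1) *
    (gam τ η (z.1 + z.2 + 1 + a) / gam τ η (z.1 + z.2 + 1 - a)) *
    (gam τ η (z.1 - z.2 + 1 + a) / gam τ η (z.1 - z.2 + 1 - a))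

def S₃ (τ η a : ℂ) : ShiftSeries (-2) := .inSecond a (intertwinerCoeff τ η a)

end Elliptic

end ParamPerm

end

/-!
The relation `S₂(-a) S₂(a) = 1` is elementary. In the deformed cases those for `S₁` and `S₃` follow
from it by a braid relation with opposite parameters and `Sᵢ(0) = 1`; without deformation they are
elementary as well. Also `S₁` and `S₃` commute, as they act on different variables. The substance is
in the two braid relations, and in all three cases each of their coefficients is an instance of one
terminating summation formula.

Let `[x]` be odd and let `{x}` be such that `⟨t, x⟩ = [t - x] {t + x}` obeys the three-term Plücker
relation and one more three-term addition formula (`Brackets`). These are `[x] = x`, `{x} = 1`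
without deformation, `[x] = q^x - q^(-x)`, `{x} = q^(-x - 1/2)` in the quantum case, and `[x] =
θ₁(2ηx)`, `{x} = L [x]` in the elliptic one. The Plücker relation makes any `⟨c + i + j, x⟩` a
combination of `⟨A - i, x⟩` and `⟨B + j, x⟩`; multiplying these relations up, and solving the
resulting Pascal recursion for the coefficients, one expands `∏_{l<n} ⟨c + l, x⟩` in the products
`∏_{l<i} ⟨A - l, x⟩ ∏_{l<j} ⟨B + l, x⟩` with `i + j = n` (`Brackets.binomial`). This is the
Frenkel–Turaev sum, with the `q`-analogue and the Pfaff–Saalschütz sum as degenerations.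

If `W (x + 1) = {x} W x`, the coefficients of the intertwining operators are the `weight`s `{z + a -
2k} W (z - k) / W (z + a - k + 1) · [-a]_k / [k]!`, and if `g (y + 2)` is proportional to `⟨y/2, x⟩
g y`, the multiplier `S₂(a)` is `g (z + 1 + a) / g (z + 1 - a)`. With these two facts, the binomial
theorem becomes the identity `Brackets.braid_sum` between the coefficients of the two sides of a
braid relation. Without deformation the roles are exchanged: the weights are the coefficients of
`S₂`, and the multipliers are those of `S₁`, `S₃`.

It remains to supply `W` and `g` and to identify the coefficients. Without deformation `g` is a
Gamma function or its reciprocal, and the weights are the Taylor coefficients of `(1 - t) ^ a`. In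
the quantum case `g` is made of the infinite products in `S₂`, and the weights come from the
`q`-binomial theorem (`Quantum.qRatio_hasFPowerSeriesAt`). In the elliptic case the addition
formulas come from writing `θ₁(x + y) θ₁(x - y)` by two even theta functions
(`Elliptic.theta₁_add_mul_theta₁_sub`), and `W`, `g` are made of elliptic gamma functions; their
functional equation `Elliptic.gam_add_two` needs the product formula for `θ₁`, hence Jacobi's triple
product (`Elliptic.jacobiTheta₂_eq_prod`).

Equality of meromorphic functions is handled as eventual equality along the filter `generic` of sets
with dense interior, which is preserved by the open maps that occur as substitutions.
-/

noncomputable section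

namespace ParamPerm

open Complex Finset Filter

/-! ### Generic points -/

/-- The filter of sets containing a dense open set. -/
def generic (X : Type*) [TopologicalSpace X] : Filter X where
  sets := {S | Dense (interior S)}
  univ_sets := by simp
  sets_of_superset h hs := h.mono (interior_mono hs)
  inter_sets h h' := by
    simp only [Set.mem_ofPred_eq, interior_inter] at *
    exact h.inter_of_isOpen_left h' isOpen_interior

theorem mem_generic_of_isOpen {X : Type*} [TopologicalSpace X] {S : Set X} (ho : IsOpen S)
    (hd : Dense S) : S ∈ generic X := by
  change Dense (interior S)
  rwa [ho.interior_eq]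

theorem tendsto_generic {X Y : Type*} [TopologicalSpace X] [TopologicalSpace Y] {f : X → Y}
    (hc : Continuous f) (ho : IsOpenMap f) : Tendsto f (generic X) (generic Y) := by
  intro S hS
  have hS' : Dense (interior S) := hS
  exact (hS'.preimage ho).mono (preimage_interior_subset_interior_preimage hc)

theorem tendsto_generic_add (v : ℂ × ℂ) :
    Tendsto (fun x => x + v) (generic (ℂ × ℂ)) (generic (ℂ × ℂ)) :=
  tendsto_generic (Homeomorph.addRight v).continuous (Homeomorph.addRight v).isOpenMap

theorem tendsto_generic_fst : Tendsto Prod.fst (generic (ℂ × ℂ)) (generic ℂ) :=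
  tendsto_generic continuous_fst isOpenMap_fst

theorem tendsto_generic_snd : Tendsto Prod.snd (generic (ℂ × ℂ)) (generic ℂ) :=
  tendsto_generic continuous_snd isOpenMap_snd

theorem tendsto_generic_swap : Tendsto Prod.swap (generic (ℂ × ℂ)) (generic (ℂ × ℂ)) :=
  tendsto_generic continuous_swap (Homeomorph.prodComm ℂ ℂ).isOpenMap

theorem tendsto_generic_affine {α β : ℂ} (h : α ≠ 0 ∨ β ≠ 0) (γ : ℂ) :
    Tendsto (fun x : ℂ × ℂ => α * x.1 + β * x.2 + γ) (generic (ℂ × ℂ)) (generic ℂ) := by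
  let f : ℂ × ℂ →L[ℂ] ℂ :=
    α • ContinuousLinearMap.fst ℂ ℂ ℂ + β • ContinuousLinearMap.snd ℂ ℂ ℂ
  have hf : Function.Surjective f := by
    intro y
    rcases h with h | h
    · exact ⟨(y / α, 0), by simp [f, mul_div_cancel₀ _ h]⟩
    · exact ⟨(0, y / β), by simp [f, mul_div_cancel₀ _ h]⟩
  exact tendsto_generic (by fun_prop)
    ((Homeomorph.addRight γ).isOpenMap.comp (f.isOpenMap hf))

theorem tendsto_generic_affine₁ {α : ℂ} (h : α ≠ 0) (γ : ℂ) :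
    Tendsto (fun z : ℂ => α * z + γ) (generic ℂ) (generic ℂ) :=
  tendsto_generic (by fun_prop)
    ((Homeomorph.addRight γ).isOpenMap.comp (Homeomorph.mulLeft₀ α h).isOpenMap)

theorem merEq_iff {f g : ℂ × ℂ → ℂ} : MerEq f g ↔ f =ᶠ[generic (ℂ × ℂ)] g := by
  constructor
  · rintro ⟨U, hU, hd, h⟩
    exact mem_of_superset (mem_generic_of_isOpen hU hd) h
  · intro h
    refine ⟨interior {x | f x = g x}, isOpen_interior, h, fun x hx => ?_⟩
    have hx' : x ∈ {x | f x = g x} := interior_subset hx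
    exact hx'

theorem eventually_forall_le {X : Type*} {l : Filter X} {p : ℕ → X → Prop} (m : ℕ)
    (h : ∀ k, ∀ᶠ x in l, p k x) : ∀ᶠ x in l, ∀ k ≤ m, p k x :=
  (eventually_all_finite (Set.finite_Iic m)).2 fun k _ => h k

theorem eventually_forall_natAbs_le {ι : Type*} {l : Filter ι} {p : ι → ℤ → Prop} (M : ℕ)
    (h : ∀ k, ∀ᶠ x in l, p x k) : ∀ᶠ x in l, ∀ k : ℤ, k.natAbs ≤ M → p x k := by
  have := (Finset.eventually_all (Icc (-M : ℤ) M)).2 fun k _ => h k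
  filter_upwards [this] with x hx k hk
  exact hx k (by rw [mem_Icc]; omega)

/-! ### Operator power series -/

theorem sum_antidiagonal_ite_fst {m : ℕ} (f : ℕ × ℕ → ℂ) :
    (∑ p ∈ antidiagonal m, if p.1 = 0 then f p else 0) = f (0, m) := by
  rw [sum_eq_single (0, m)]
  · simp
  · rintro ⟨i, j⟩ h h'
    rw [HasAntidiagonal.mem_antidiagonal] at h
    simp only at h
    rw [if_neg]
    rintro rfl
    simp at h
    simp [h] at h'
  · simp

theorem sum_antidiagonal_ite_snd {m : ℕ} (f : ℕ × ℕ → ℂ) :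
    (∑ p ∈ antidiagonal m, if p.2 = 0 then f p else 0) = f (m, 0) := by
  rw [sum_eq_single (m, 0)]
  · simp
  · rintro ⟨i, j⟩ h h'
    rw [HasAntidiagonal.mem_antidiagonal] at h
    simp only at h
    rw [if_neg]
    rintro rfl
    simp at h
    simp [h] at h'
  · simp

namespace ShiftSeries

variable {s : ℂ}

theorem equiv_iff {A B : ShiftSeries s} :
    A ≈ B ↔ A.lead = B.lead ∧ ∀ m n, A.coeff m n =ᶠ[generic (ℂ × ℂ)] B.coeff m n :=
  and_congr_right fun _ => forall₂_congr fun _ _ => merEq_iff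

theorem mul_coeff (A B : ShiftSeries s) (m n : ℕ) (x : ℂ × ℂ) :
    (A * B).coeff m n x = ∑ p ∈ antidiagonal m, ∑ r ∈ antidiagonal n, A.coeff p.1 r.1 x *
      B.coeff p.2 r.2 (x + A.lead + (s * (p.1 : ℂ), s * (r.1 : ℂ))) := rfl

theorem mul_congr {A A' B B' : ShiftSeries s} (hA : A ≈ A') (hB : B ≈ B') : A * B ≈ A' * B' := by
  rw [equiv_iff] at *
  refine ⟨congrArg₂ (· + ·) hA.1 hB.1, fun m n => ?_⟩
  have h1 : ∀ᶠ x in generic (ℂ × ℂ), ∀ p ∈ antidiagonal m, ∀ r ∈ antidiagonal n,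
      A.coeff p.1 r.1 x = A'.coeff p.1 r.1 x :=
    (eventually_all_finset _).2 fun p _ => (eventually_all_finset _).2 fun r _ => hA.2 _ _
  have h2 : ∀ᶠ x in generic (ℂ × ℂ), ∀ p ∈ antidiagonal m, ∀ r ∈ antidiagonal n,
      B.coeff p.2 r.2 (x + (A.lead + (s * (p.1 : ℂ), s * (r.1 : ℂ)))) =
        B'.coeff p.2 r.2 (x + (A.lead + (s * (p.1 : ℂ), s * (r.1 : ℂ)))) :=
    (eventually_all_finset _).2 fun p _ => (eventually_all_finset _).2 fun r _ =>
      (tendsto_generic_add _).eventually (hB.2 _ _)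
  filter_upwards [h1, h2] with x h1 h2
  rw [mul_coeff, mul_coeff]
  refine sum_congr rfl fun p hp => sum_congr rfl fun r hr => ?_
  rw [← hA.1, h1 p hp r hr, add_assoc, h2 p hp r hr]

@[simp] theorem mul_lead (A B : ShiftSeries s) : (A * B).lead = A.lead + B.lead := rfl

@[simp] theorem one_lead : (1 : ShiftSeries s).lead = 0 := rfl

@[simp] theorem multiplication_lead (f : ℂ × ℂ → ℂ) :
    (multiplication f : ShiftSeries s).lead = 0 := rfl

@[simp] theorem inFirst_lead (α : ℂ) (c : ℕ → ℂ → ℂ) :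
    (inFirst α c : ShiftSeries s).lead = (α, 0) := rfl

@[simp] theorem inSecond_lead (α : ℂ) (c : ℕ → ℂ → ℂ) :
    (inSecond α c : ShiftSeries s).lead = (0, α) := rfl

theorem multiplication_mul_coeff (f : ℂ × ℂ → ℂ) (B : ShiftSeries s) (m n : ℕ) (x : ℂ × ℂ) :
    (multiplication f * B).coeff m n x = f x * B.coeff m n x := by
  have : ∀ p r : ℕ × ℕ, (if p.1 = 0 ∧ r.1 = 0 then f x else 0) *
      B.coeff p.2 r.2 (x + 0 + (s * (p.1 : ℂ), s * (r.1 : ℂ))) = if p.1 = 0 then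
        if r.1 = 0 then f x * B.coeff p.2 r.2 (x + 0 + (s * (p.1 : ℂ), s * (r.1 : ℂ))) else 0
      else 0 := by
    intro p r
    split_ifs <;> simp_all
  simp only [mul_coeff, multiplication, this, sum_antidiagonal_ite_fst,
    sum_ite_irrel, sum_const_zero]
  rw [show x + 0 + (s * ((0 : ℕ) : ℂ), s * ((0 : ℕ) : ℂ)) = x by ext <;> simp]

theorem mul_multiplication_coeff (A : ShiftSeries s) (f : ℂ × ℂ → ℂ) (m n : ℕ) (x : ℂ × ℂ) :
    (A * multiplication f).coeff m n x =
      A.coeff m n x * f (x + A.lead + (s * (m : ℂ), s * (n : ℂ))) := by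
  have : ∀ p r : ℕ × ℕ, A.coeff p.1 r.1 x * (if p.2 = 0 ∧ r.2 = 0 then
      f (x + A.lead + (s * (p.1 : ℂ), s * (r.1 : ℂ))) else 0) = if p.2 = 0 then
        if r.2 = 0 then A.coeff p.1 r.1 x * f (x + A.lead + (s * (p.1 : ℂ), s * (r.1 : ℂ))) else 0
      else 0 := by
    intro p r
    split_ifs <;> simp_all
  simp only [mul_coeff, multiplication, this, sum_antidiagonal_ite_snd,
    sum_ite_irrel, sum_const_zero]

theorem mul_one_equiv (A : ShiftSeries s) : A * 1 ≈ A := by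
  refine equiv_iff.2 ⟨by simp, fun m n => Eventually.of_forall fun x => ?_⟩
  exact (mul_multiplication_coeff _ _ _ _ _).trans (mul_one _)

theorem inFirst_mul_inSecond_equiv (α β : ℂ) (c d : ℕ → ℂ → ℂ) :
    (inFirst α c : ShiftSeries s) * inSecond β d ≈ inSecond β d * inFirst α c := by
  refine equiv_iff.2 ⟨by simp, fun m n => Eventually.of_forall fun x => ?_⟩
  have h1 : ∀ p r : ℕ × ℕ, (if r.1 = 0 then c p.1 x.1 else 0) *
      (if p.2 = 0 then d r.2 ((x + (α, 0) + (s * (p.1 : ℂ), s * (r.1 : ℂ))).2) else 0) =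
      if p.2 = 0 then if r.1 = 0 then c p.1 x.1 * d r.2 x.2 else 0 else 0 := by
    intro p r
    split_ifs <;> simp_all
  have h2 : ∀ p r : ℕ × ℕ, (if p.1 = 0 then d r.1 x.2 else 0) *
      (if r.2 = 0 then c p.2 ((x + (0, β) + (s * (p.1 : ℂ), s * (r.1 : ℂ))).1) else 0) =
      if p.1 = 0 then if r.2 = 0 then d r.1 x.2 * c p.2 x.1 else 0 else 0 := by
    intro p r
    split_ifs <;> simp_all
  simp only [mul_coeff, inFirst, inSecond, h1, h2, sum_antidiagonal_ite_fst,
    sum_antidiagonal_ite_snd, sum_ite_irrel, sum_const_zero]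
  exact mul_comm _ _

/-- The coefficients of the left side of a braid relation. -/
theorem inFirst_mul_multiplication_mul_inFirst_coeff (α β : ℂ) (c d : ℕ → ℂ → ℂ) (f : ℂ × ℂ → ℂ)
    (m n : ℕ) (x : ℂ × ℂ) :
    ((inFirst α c : ShiftSeries s) * multiplication f * inFirst β d).coeff m n x =
      if n = 0 then ∑ k ∈ antidiagonal m, c k.1 x.1 * f (x.1 + α + s * k.1, x.2) *
        d k.2 (x.1 + α + s * k.1) else 0 := by
  rw [mul_coeff]
  have : ∀ p r : ℕ × ℕ, r ∈ antidiagonal n →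
      ((inFirst α c : ShiftSeries s) * multiplication f).coeff p.1 r.1 x *
      (inFirst β d : ShiftSeries s).coeff p.2 r.2
        (x + ((inFirst α c : ShiftSeries s) * multiplication f).lead +
          (s * (p.1 : ℂ), s * (r.1 : ℂ))) =
      if n = 0 then if r.1 = 0 then c p.1 x.1 * f (x.1 + α + s * p.1, x.2) *
        d p.2 (x.1 + α + s * p.1) else 0 else 0 := by
    rintro p ⟨i, j⟩ hr
    rw [HasAntidiagonal.mem_antidiagonal] at hr
    rw [mul_multiplication_coeff]
    simp only [inFirst] at hr ⊢
    by_cases h1 : i = 0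
    · by_cases h2 : j = 0
      · have : n = 0 := by omega
        subst h1 h2 this
        simp
        left
        rw [show x + (α, 0) + (s * (p.1 : ℂ), 0) = (x.1 + α + s * p.1, x.2) by ext <;> simp]
        exact Or.inl rfl
      · have : n ≠ 0 := by omega
        simp [h2, this]
    · simp [h1]
  rw [sum_congr rfl fun p _ => sum_congr rfl fun r hr => this p r hr]
  simp only [sum_ite_irrel, sum_const_zero, sum_antidiagonal_ite_fst]

/-- The coefficients of the right side of a braid relation. -/
theorem multiplication_mul_inFirst_mul_multiplication_coeff (α : ℂ) (c : ℕ → ℂ → ℂ)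
    (f g : ℂ × ℂ → ℂ) (m n : ℕ) (x : ℂ × ℂ) :
    (multiplication f * (inFirst α c : ShiftSeries s) * multiplication g).coeff m n x =
      if n = 0 then f x * c m x.1 * g (x.1 + α + s * m, x.2) else 0 := by
  rw [mul_multiplication_coeff, multiplication_mul_coeff]
  by_cases h : n = 0
  · subst h
    simp [inFirst]
    left
    rw [show x + (α, 0) + (s * (m : ℂ), 0) = (x.1 + α + s * m, x.2) by ext <;> simp]
  · simp [inFirst, h]

/-- Exchange of the two variables. -/
def swap (A : ShiftSeries s) : ShiftSeries s where
  lead := A.lead.swap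
  coeff m n x := A.coeff n m x.swap

theorem swap_mul (A B : ShiftSeries s) : (A * B).swap = A.swap * B.swap := by
  have h1 : (A * B).swap.lead = (A.swap * B.swap).lead := rfl
  have h2 : (A * B).swap.coeff = (A.swap * B.swap).coeff := by
    funext m n x
    simp only [swap, mul_coeff]
    rw [sum_comm]
    rfl
  cases h : (A * B).swap
  cases h' : A.swap * B.swap
  simp_all

theorem swap_equiv {A B : ShiftSeries s} (h : A ≈ B) : A.swap ≈ B.swap := by
  rw [equiv_iff] at *
  exact ⟨congrArg Prod.swap h.1, fun m n => tendsto_generic_swap.eventually (h.2 n m)⟩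

theorem swap_inFirst (α : ℂ) (c : ℕ → ℂ → ℂ) :
    (inFirst α c : ShiftSeries s).swap = inSecond α c := rfl

theorem swap_multiplication (f : ℂ × ℂ → ℂ) :
    (multiplication fun x => f x.swap : ShiftSeries s).swap = multiplication f := by
  simp [swap, multiplication, and_comm]

theorem multiplication_equiv_one {f : ℂ × ℂ → ℂ} (h : ∀ᶠ x in generic (ℂ × ℂ), f x = 1) :
    (multiplication f : ShiftSeries s) ≈ 1 := by
  refine equiv_iff.2 ⟨rfl, fun m n => ?_⟩
  filter_upwards [h] with x hx
  change (if _ then _ else _) = if _ then _ else _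
  rw [hx]

theorem inFirst_equiv_one {c : ℕ → ℂ → ℂ}
    (h : ∀ k, ∀ᶠ z in generic ℂ, c k z = if k = 0 then 1 else 0) :
    (inFirst 0 c : ShiftSeries s) ≈ 1 := by
  refine equiv_iff.2 ⟨rfl, fun m n => ?_⟩
  filter_upwards [tendsto_generic_fst.eventually (h m)] with x hx
  change (if _ then _ else _) = if _ then _ else _
  rw [hx]
  split_ifs <;> simp_all

/-- The Coxeter relations from the identities `h1`, `h2` between the coefficients of the two braid
relations. The relation for `S₃` is that for `S₁` with the variables exchanged, so that in `h2` the
moving variable is also called `x.1`. The factor `ε` is the sign of the leading shift. -/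
theorem coxeterRelations {ε : ℂ} {c : ℂ → ℕ → ℂ → ℂ} {φ : ℂ → ℂ × ℂ → ℂ}
    (hφ0 : ∀ᶠ x in generic (ℂ × ℂ), φ 0 x = 1)
    (hφ : ∀ a, ∀ᶠ x in generic (ℂ × ℂ), φ (-a) x * φ a x = 1)
    (hc : ∀ k, ∀ᶠ z in generic ℂ, c 0 k z = if k = 0 then 1 else 0)
    (h1 : ∀ a b m, ∀ᶠ x in generic (ℂ × ℂ),
      ∑ k ∈ antidiagonal m, c a k.1 x.1 * φ (a + b) (x.1 + ε * a + s * k.1, x.2) *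
        c b k.2 (x.1 + ε * a + s * k.1) =
      φ b x * c (a + b) m x.1 * φ a (x.1 + ε * (a + b) + s * m, x.2))
    (h2 : ∀ a b m, ∀ᶠ x in generic (ℂ × ℂ),
      ∑ k ∈ antidiagonal m, c a k.1 x.1 * φ (a + b) (x.2, x.1 + ε * a + s * k.1) *
        c b k.2 (x.1 + ε * a + s * k.1) =
      φ b x.swap * c (a + b) m x.1 * φ a (x.2, x.1 + ε * (a + b) + s * m)) :
    CoxeterRelations (fun a => (inFirst (ε * a) (c a) : ShiftSeries s))
      (fun a => multiplication (φ a)) (fun a => inSecond (ε * a) (c a)) := by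
  have hS2 : (multiplication (φ 0) : ShiftSeries s) ≈ 1 := multiplication_equiv_one hφ0
  have hS1 : (inFirst (ε * 0) (c 0) : ShiftSeries s) ≈ 1 := by
    rw [mul_zero]; exact inFirst_equiv_one hc
  have hS3 : (inSecond (ε * 0) (c 0) : ShiftSeries s) ≈ 1 := by
    refine Setoid.trans (swap_equiv hS1) ?_
    rw [show (1 : ShiftSeries s).swap = 1 from swap_multiplication (s := s) fun _ => 1]
  have hinv : ∀ a, (multiplication (φ (-a)) * multiplication (φ a) : ShiftSeries s) ≈ 1 := by
    intro a
    refine equiv_iff.2 ⟨by simp, fun m n => ?_⟩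
    filter_upwards [hφ a] with x hx
    rw [multiplication_mul_coeff]
    change _ * (if _ then _ else _) = if _ then _ else _
    split_ifs
    · exact hx
    · simp
  have b1 : ∀ a b, (inFirst (ε * a) (c a) * multiplication (φ (a + b)) * inFirst (ε * b) (c b) :
      ShiftSeries s) ≈
      multiplication (φ b) * inFirst (ε * (a + b)) (c (a + b)) * multiplication (φ a) := by
    intro a b
    refine equiv_iff.2 ⟨by simp [mul_add], fun m n => ?_⟩
    filter_upwards [h1 a b m] with x hx
    rw [inFirst_mul_multiplication_mul_inFirst_coeff,
      multiplication_mul_inFirst_mul_multiplication_coeff, hx]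
  have b2 : ∀ a b, (inSecond (ε * a) (c a) * multiplication (φ (a + b)) * inSecond (ε * b) (c b) :
      ShiftSeries s) ≈
      multiplication (φ b) * inSecond (ε * (a + b)) (c (a + b)) * multiplication (φ a) := by
    intro a b
    simp only [← swap_inFirst, ← swap_multiplication (φ _), ← swap_mul]
    refine swap_equiv (equiv_iff.2 ⟨by simp [mul_add], fun m n => ?_⟩)
    filter_upwards [h2 a b m] with x hx
    rw [inFirst_mul_multiplication_mul_inFirst_coeff,
      multiplication_mul_inFirst_mul_multiplication_coeff]
    exact congrArg (fun y => if n = 0 then y else 0) hx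
  refine ⟨fun a => ?_, hinv, fun a => ?_, fun a b => inFirst_mul_inSecond_equiv _ _ _ _, b1,
    fun a b => ?_⟩
  -- inverses: the braid relation with parameters `-a`, `a` and `S₁ 0 = S₂ 0 = 1`
  · have h := b1 (-a) a
    rw [neg_add_cancel] at h
    refine Setoid.trans (mul_congr (Setoid.symm (mul_one_equiv _)) (Setoid.refl _)) ?_
    refine Setoid.trans (mul_congr (mul_congr (Setoid.refl _) (Setoid.symm hS2))
      (Setoid.refl _)) (Setoid.trans h ?_)
    refine Setoid.trans (mul_congr (mul_congr (Setoid.refl _) hS1) (Setoid.refl _)) ?_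
    refine Setoid.trans (mul_congr (mul_one_equiv _) (Setoid.refl _)) ?_
    simpa using hinv (-a)
  · have h := b2 (-a) a
    rw [neg_add_cancel] at h
    refine Setoid.trans (mul_congr (Setoid.symm (mul_one_equiv _)) (Setoid.refl _)) ?_
    refine Setoid.trans (mul_congr (mul_congr (Setoid.refl _) (Setoid.symm hS2))
      (Setoid.refl _)) (Setoid.trans h ?_)
    refine Setoid.trans (mul_congr (mul_congr (Setoid.refl _) hS3) (Setoid.refl _)) ?_
    refine Setoid.trans (mul_congr (mul_one_equiv _) (Setoid.refl _)) ?_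
    simpa using hinv (-a)
  · have h := b2 b a
    rw [add_comm b a] at h
    exact Setoid.symm h

end ShiftSeries

/-! ### The binomial theorem for brackets -/

/-- Rising product `f(x) f(x+1) ⋯ f(x+n-1)`. -/
def rising (f : ℂ → ℂ) (x : ℂ) (n : ℕ) : ℂ := ∏ l ∈ range n, f (x + l)

@[simp] theorem rising_zero (f : ℂ → ℂ) (x : ℂ) : rising f x 0 = 1 := by simp [rising]

theorem rising_succ (f : ℂ → ℂ) (x : ℂ) (n : ℕ) :
    rising f x (n + 1) = rising f x n * f (x + n) := by
  simp [rising, prod_range_succ]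

theorem rising_succ_left (f : ℂ → ℂ) (x : ℂ) (n : ℕ) :
    rising f x (n + 1) = f x * rising f (x + 1) n := by
  simp only [rising, prod_range_succ', mul_comm]
  congr 1
  · simp
  · refine prod_congr rfl fun l _ => ?_
    push_cast
    ring_nf

/-- A general binomial theorem: if each `s (i + j)` is a combination of `p i` and
`r j`, then `∏ s` expands in the products of initial `p`s and initial `r`s, with coefficients given
by the corresponding Pascal recursion. -/
theorem prod_eq_sum_antidiagonal_of_pascal {R : Type*} [CommRing R] (s p r : ℕ → R)
    (α β C : ℕ → ℕ → R)
    (n : ℕ) (hs : ∀ i j, i + j < n → s (i + j) = α i j * p i + β i j * r j)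
    (h0 : C 0 0 = 1)
    (hl : ∀ i, i < n → C (i + 1) 0 = α i 0 * C i 0)
    (hr : ∀ j, j < n → C 0 (j + 1) = β 0 j * C 0 j)
    (hc : ∀ i j, i + j + 1 < n →
      C (i + 1) (j + 1) = α i (j + 1) * C i (j + 1) + β (i + 1) j * C (i + 1) j) :
    ∏ l ∈ range n, s l =
      ∑ k ∈ antidiagonal n, C k.1 k.2 * (∏ l ∈ range k.1, p l) * ∏ l ∈ range k.2, r l := by
  -- the two terms of the recursion, extended by `0` to the boundary of the quadrant
  let X : ℕ → ℕ → R := fun i j => Nat.casesOn i 0 fun i => α i j * C i j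
  let Y : ℕ → ℕ → R := fun i j => Nat.casesOn j 0 fun j => β i j * C i j
  induction n with
  | zero => simp [h0]
  | succ n ih =>
    replace ih := ih (fun i j h => hs i j (by omega)) (fun i h => hl i (by omega))
      (fun j h => hr j (by omega)) (fun i j h => hc i j (by omega))
    have hXY : ∀ i j, i + j = n + 1 → C i j = X i j + Y i j := by
      rintro (_ | i) (_ | j) h
      · simp at h
      · simp [X, Y, hr j (by omega)]
      · simp [X, Y, hl i (by omega)]
      · simp [X, Y, hc i j (by omega)]
    have key : ∑ k ∈ antidiagonal (n + 1),
        C k.1 k.2 * (∏ l ∈ range k.1, p l) * ∏ l ∈ range k.2, r l =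
        ∑ k ∈ antidiagonal (n + 1), X k.1 k.2 * (∏ l ∈ range k.1, p l) * ∏ l ∈ range k.2, r l +
        ∑ k ∈ antidiagonal (n + 1),
          Y k.1 k.2 * (∏ l ∈ range k.1, p l) * ∏ l ∈ range k.2, r l := by
      rw [← sum_add_distrib]
      refine sum_congr rfl fun k hk => ?_
      rw [HasAntidiagonal.mem_antidiagonal] at hk
      rw [hXY _ _ hk]
      ring
    rw [key, Nat.sum_antidiagonal_succ, Nat.sum_antidiagonal_succ', prod_range_succ, ih, sum_mul]
    have hX : ∀ j, X 0 j = 0 := fun _ => rfl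
    have hY : ∀ i, Y i 0 = 0 := fun _ => rfl
    have hX' : ∀ i j, X (i + 1) j = α i j * C i j := fun _ _ => rfl
    have hY' : ∀ i j, Y i (j + 1) = β i j * C i j := fun _ _ => rfl
    simp only [hX, hY, hX', hY', zero_mul, zero_add]
    rw [← sum_add_distrib]
    refine sum_congr rfl fun k hk => ?_
    rw [HasAntidiagonal.mem_antidiagonal] at hk
    rw [← hk, hs _ _ (by omega), prod_range_succ, prod_range_succ]
    ring

/-- Functions `br x = [x]` and `cu x = {x}` obeying the addition formulas from which the binomial
theorem `Brackets.binomial` follows: `plucker` is the three-term relation of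
`⟨x, y⟩ = [x - y] {x + y}`, and `pascal` is what the recursion for the binomial coefficients
amounts to. -/
structure Brackets (br cu : ℂ → ℂ) : Prop where
  neg : ∀ x, br (-x) = -br x
  nat_ne_zero : ∀ k : ℕ, br (k + 1) ≠ 0
  plucker : ∀ x y u v,
    br (x - y) * cu (x + y) * (br (u - v) * cu (u + v)) -
      br (x - u) * cu (x + u) * (br (y - v) * cu (y + v)) +
      br (x - v) * cu (x + v) * (br (y - u) * cu (y + u)) = 0
  pascal : ∀ N M P k,
    br N * br M * (cu P * cu (P - M + N - 2 * k)) =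
      br (N - k) * br (M + k) * (cu (P - k) * cu (P - M + N - k)) +
      br k * br (M + k - N) * (cu (P - M - k) * cu (P + N - k))

/-- The coefficients in the binomial theorem `Brackets.binomial`, with `i` factors based at `A`
and `j` factors based at `B`. -/
def binomCoeff (br cu : ℂ → ℂ) (A B c : ℂ) (i j : ℕ) : ℂ :=
  rising br 1 (i + j) / (rising br 1 i * rising br 1 j) *
    ((-1) ^ i * rising br (c - B) i * rising br (c - A + i) j) *
    (rising cu (c + B + j) i * rising cu (c + A) j /
      (rising cu (A + B - i) j * rising cu (A + B + j - i + 1) i))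

variable {br cu : ℂ → ℂ}

theorem Brackets.rising_one_ne_zero (h : Brackets br cu) (n : ℕ) : rising br 1 n ≠ 0 := by
  rw [rising, prod_ne_zero_iff]
  intro l _
  rw [add_comm]
  exact h.nat_ne_zero l

/-- The Pascal recursion of `binomCoeff`, in its interior. -/
theorem Brackets.binomCoeff_succ_succ (h : Brackets br cu) (A B c : ℂ) (i j : ℕ)
    (hcu : ∀ k : ℤ, k.natAbs ≤ i + j + 2 → cu (A + B + k) ≠ 0) :
    binomCoeff br cu A B c (i + 1) (j + 1) =
      -(br (c - B + i) * cu (c + B + i + 2 * (j + 1 : ℕ)) / cu (A + B + (j + 1 : ℕ) - i)) *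
        binomCoeff br cu A B c i (j + 1) +
      br (c - A + (i + 1 : ℕ) + j + (i + 1 : ℕ)) * cu (c + A + j) / cu (A + B + j - (i + 1 : ℕ)) *
        binomCoeff br cu A B c (i + 1) j := by
  have e1 : cu (A + B - i - 1) ≠ 0 := by
    have := hcu (-i - 1) (by omega)
    push_cast at this
    convert this using 2; ring
  have e2 : cu (A + B + j - i + 1) ≠ 0 := by
    have := hcu (j - i + 1) (by omega)
    push_cast at this
    convert this using 2; ring
  have e3 : cu (A + B - i + j) ≠ 0 := by
    have := hcu (j - i) (by omega)
    push_cast at this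
    convert this using 2; ring
  have e4 : cu (A + B - i - 1 + j) ≠ 0 := by
    have := hcu (j - i - 1) (by omega)
    push_cast at this
    convert this using 2; ring
  have e5 : cu (A + B + j + 1) ≠ 0 := by
    have := hcu (j + 1) (by omega)
    push_cast at this
    convert this using 2; ring
  have d1 : rising cu (A + B - i) j ≠ 0 := by
    rw [rising, prod_ne_zero_iff]
    intro l hl
    have := hcu (l - i) (by rw [mem_range] at hl; omega)
    push_cast at this
    convert this using 2; ring
  have d2 : rising cu (A + B + j - i + 2) i ≠ 0 := by
    rw [rising, prod_ne_zero_iff]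
    intro l hl
    have := hcu (j + l - i + 2) (by rw [mem_range] at hl; omega)
    push_cast at this
    convert this using 2; ring
  -- the denominators of the three coefficients
  have D1 : rising cu (A + B - (i + 1 : ℕ)) (j + 1) =
      cu (A + B - i - 1) * rising cu (A + B - i) j := by
    rw [rising_succ_left]; push_cast; ring_nf
  have D2 : rising cu (A + B + (j + 1 : ℕ) - (i + 1 : ℕ) + 1) (i + 1) =
      cu (A + B + j - i + 1) * rising cu (A + B + j - i + 2) i := by
    rw [rising_succ_left]; push_cast; ring_nf
  have D3 : rising cu (A + B - i) (j + 1) = rising cu (A + B - i) j * cu (A + B - i + j) :=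
    rising_succ _ _ _
  have D4 : rising cu (A + B + (j + 1 : ℕ) - i + 1) i = rising cu (A + B + j - i + 2) i := by
    push_cast; ring_nf
  have D5 : rising cu (A + B - (i + 1 : ℕ)) j =
      cu (A + B - i - 1) * rising cu (A + B - i) j / cu (A + B - i - 1 + j) := by
    rw [eq_div_iff e4, ← D1, rising_succ]; push_cast; ring_nf
  have D6 : rising cu (A + B + j - (i + 1 : ℕ) + 1) (i + 1) =
      cu (A + B - i + j) *
        (cu (A + B + j - i + 1) * rising cu (A + B + j - i + 2) i / cu (A + B + j + 1)) := by
    have : cu (A + B + j - i + 1) * rising cu (A + B + j - i + 2) i =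
        rising cu (A + B + j - i + 1) i * cu (A + B + j + 1) := by
      rw [← D2]
      have := rising_succ cu (A + B + j - i + 1) i
      push_cast; ring_nf at this ⊢; exact this
    rw [this, mul_div_cancel_right₀ _ e5, rising_succ_left]; push_cast; ring_nf
  -- the numerators
  have N1 : rising br (c - B) (i + 1) = rising br (c - B) i * br (c - B + i) := rising_succ _ _ _
  have N2 : rising br (c - A + (i + 1 : ℕ)) (j + 1) =
      rising br (c - A + i + 1) j * br (c - A + i + j + 1) := by
    rw [rising_succ]; push_cast; ring_nf
  have N3 : rising br (c - A + i) (j + 1) = br (c - A + i) * rising br (c - A + i + 1) j :=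
    rising_succ_left _ _ _
  have N4 : rising br (c - A + (i + 1 : ℕ)) j = rising br (c - A + i + 1) j := by
    push_cast; ring_nf
  have N5 : rising cu (c + B + (j + 1 : ℕ)) (i + 1) =
      rising cu (c + B + j + 1) i * cu (c + B + i + j + 1) := by
    rw [rising_succ]; push_cast; ring_nf
  have N6 : rising cu (c + B + (j + 1 : ℕ)) i = rising cu (c + B + j + 1) i := by
    push_cast; ring_nf
  have N7 : rising cu (c + B + j) (i + 1) = cu (c + B + j) * rising cu (c + B + j + 1) i :=
    rising_succ_left _ _ _
  have N8 : rising cu (c + A) (j + 1) = rising cu (c + A) j * cu (c + A + j) := rising_succ _ _ _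
  -- the factorials
  have F1 : rising br 1 (i + 1 + (j + 1)) = rising br 1 (i + j + 1) * br (i + j + 2) := by
    rw [show i + 1 + (j + 1) = i + j + 1 + 1 by ring, rising_succ]; push_cast; ring_nf
  have F2 : rising br 1 (i + 1) = rising br 1 i * br (i + 1) := by
    rw [rising_succ]; ring_nf
  have F3 : rising br 1 (j + 1) = rising br 1 j * br (j + 1) := by
    rw [rising_succ]; ring_nf
  have f1 := h.rising_one_ne_zero i
  have f2 := h.rising_one_ne_zero j
  have f3 := h.nat_ne_zero i
  have f4 := h.nat_ne_zero j
  have hp := h.pascal (i + j + 2) (c - A + i + j + 1) (c + B + i + j + 1) (i + 1)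
  rw [show c + B + i + j + 1 - (c - A + i + j + 1) + (i + j + 2) - 2 * (i + 1 : ℂ) =
      A + B - i + j by ring, show (i + j + 2 - (i + 1) : ℂ) = j + 1 by ring,
    show c - A + i + j + 1 + (i + 1) = c - A + 2 * i + j + 2 by ring,
    show c + B + i + j + 1 - (i + 1) = c + B + j by ring,
    show c + B + i + j + 1 - (c - A + i + j + 1) + (i + j + 2) - (i + 1 : ℂ) =
      A + B + j + 1 by ring,
    show c - A + 2 * i + j + 2 - (i + j + 2 : ℂ) = c - A + i by ring,
    show c + B + i + j + 1 - (c - A + i + j + 1) - (i + 1) = A + B - i - 1 by ring,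
    show c + B + i + j + 1 + (i + j + 2) - (i + 1) = c + B + i + 2 * j + 2 by ring] at hp
  have G1 : c + B + i + 2 * (j + 1 : ℕ) = c + B + i + 2 * j + 2 := by push_cast; ring
  have G2 : A + B + (j + 1 : ℕ) - i = A + B + j - i + 1 := by push_cast; ring
  have G3 : c - A + (i + 1 : ℕ) + j + (i + 1 : ℕ) = c - A + 2 * i + j + 2 := by push_cast; ring
  have G4 : A + B + j - (i + 1 : ℕ) = A + B - i - 1 + j := by push_cast; ring
  have G5 : i + (j + 1) = i + j + 1 := by ring
  have G6 : i + 1 + j = i + j + 1 := by ring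
  simp only [binomCoeff]
  rw [F1, F2, F3, G5, G6, D1, D2, D3, D4, D5, D6, G1, G2, G3, G4, N1, N2, N3, N4, N5, N6, N7, N8]
  generalize rising br 1 (i + j + 1) = R0 at *
  generalize rising br 1 i = R1 at *
  generalize rising br 1 j = R2 at *
  generalize rising cu (A + B - i) j = R3 at *
  generalize rising cu (A + B + j - i + 2) i = R4 at *
  generalize rising br (c - B) i = R5 at *
  generalize rising br (c - A + i + 1) j = R6 at *
  generalize rising cu (c + B + j + 1) i = R7 at *
  generalize rising cu (c + A) j = R8 at *
  generalize br (i + j + 2 : ℂ) = x1 at *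
  generalize br (i + 1 : ℂ) = x2 at *
  generalize br (j + 1 : ℂ) = x3 at *
  generalize cu (A + B - i - 1) = x4 at *
  generalize cu (A + B + j - i + 1) = x5 at *
  generalize cu (A + B - i + j) = x6 at *
  generalize cu (A + B - i - 1 + j) = x7 at *
  generalize cu (A + B + j + 1) = x8 at *
  generalize br (c - B + i) = x9 at *
  generalize br (c - A + i) = x10 at *
  generalize br (c - A + i + j + 1) = x11 at *
  generalize br (c - A + 2 * i + j + 2) = x12 at *
  generalize cu (c + B + i + j + 1) = x13 at *
  generalize cu (c + B + j) = x14 at *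
  generalize cu (c + B + i + 2 * j + 2) = x15 at *
  generalize cu (c + A + j) = x16 at *
  field_simp
  linear_combination (-(R0 * R5 * x9 * R6 * R7 * R8 * x16 * (-1) ^ i)) * hp

theorem Brackets.binomCoeff_succ_zero (h : Brackets br cu) (A B c : ℂ) (i : ℕ)
    (hcu : ∀ k : ℤ, k.natAbs ≤ i + 1 → cu (A + B + k) ≠ 0) :
    binomCoeff br cu A B c (i + 1) 0 =
      -(br (c - B + i) * cu (c + B + i + 2 * (0 : ℕ)) / cu (A + B + (0 : ℕ) - i)) *
        binomCoeff br cu A B c i 0 := by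
  have e1 : cu (A + B - i) ≠ 0 := by
    have := hcu (-i) (by omega)
    push_cast at this
    rwa [← sub_eq_add_neg] at this
  have d2 : rising cu (A + B - i + 1) i ≠ 0 := by
    rw [rising, prod_ne_zero_iff]
    intro l hl
    have := hcu (l - i + 1) (by rw [mem_range] at hl; omega)
    push_cast at this
    convert this using 2; ring
  have f1 := h.rising_one_ne_zero i
  have f2 := h.rising_one_ne_zero (i + 1)
  have D2 : rising cu (A + B + (0 : ℕ) - (i + 1 : ℕ) + 1) (i + 1) =
      cu (A + B - i) * rising cu (A + B - i + 1) i := by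
    rw [rising_succ_left]; push_cast; ring_nf
  rw [binomCoeff, D2]
  simp only [binomCoeff, add_zero, rising_zero, rising_succ br (c - B), Nat.cast_zero, mul_zero,
    rising_succ cu (c + B), pow_succ]
  field_simp

theorem Brackets.binomCoeff_zero_succ (h : Brackets br cu) (A B c : ℂ) (j : ℕ)
    (hcu : ∀ k : ℤ, k.natAbs ≤ j + 1 → cu (A + B + k) ≠ 0) :
    binomCoeff br cu A B c 0 (j + 1) =
      br (c - A + (0 : ℕ) + j + (0 : ℕ)) * cu (c + A + j) / cu (A + B + j - (0 : ℕ)) *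
        binomCoeff br cu A B c 0 j := by
  have e1 : cu (A + B + j) ≠ 0 := hcu j (by omega)
  have d2 : rising cu (A + B) j ≠ 0 := by
    rw [rising, prod_ne_zero_iff]
    intro l hl
    exact hcu l (by rw [mem_range] at hl; omega)
  have f1 := h.rising_one_ne_zero j
  have f2 := h.rising_one_ne_zero (j + 1)
  simp only [binomCoeff, zero_add, rising_zero, Nat.cast_zero, sub_zero, add_zero,
    rising_succ br (c - A), rising_succ cu (c + A), rising_succ cu (A + B), pow_zero]
  field_simp

theorem Brackets.zero (h : Brackets br cu) : br 0 = 0 := by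
  have := h.neg 0
  rw [neg_zero] at this
  linear_combination this / 2

/-- The binomial theorem for brackets, a form of the Frenkel–Turaev summation formula. The
factor `[B - A]_n` is moved into the linear factors, so that `B = A` needs no exception. -/
theorem Brackets.binomial (h : Brackets br cu) (A B c x : ℂ) (n : ℕ)
    (hcu : ∀ k : ℤ, k.natAbs ≤ n → cu (A + B + k) ≠ 0) :
    rising br (B - A) n * ∏ l ∈ range n, (br (c + l - x) * cu (c + l + x)) =
      ∑ k ∈ HasAntidiagonal.antidiagonal n, binomCoeff br cu A B c k.1 k.2 *
        (∏ l ∈ range k.1, (br (A - l - x) * cu (A - l + x))) *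
        ∏ l ∈ range k.2, (br (B + l - x) * cu (B + l + x)) := by
  rw [rising, ← prod_mul_distrib]
  refine prod_eq_sum_antidiagonal_of_pascal
    (fun l => br (B - A + l) * (br (c + l - x) * cu (c + l + x)))
    (fun l => br (A - l - x) * cu (A - l + x)) (fun l => br (B + l - x) * cu (B + l + x))
    (fun i j => -(br (c - B + i) * cu (c + B + i + 2 * j) / cu (A + B + j - i)))
    (fun i j => br (c - A + i + j + i) * cu (c + A + j) / cu (A + B + j - i))
    (binomCoeff br cu A B c) n ?_ ?_ ?_ ?_ ?_
  · intro i j hij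
    have e : cu (A + B + j - i) ≠ 0 := by
      have := hcu (j - i) (by omega)
      push_cast at this
      convert this using 2; ring
    -- the point `s (i + j)` is a combination of `p i` and `r j`, as all three lie on a line
    have hp := h.plucker (c + i + j) x (A - i) (B + j)
    have n1 := h.neg (B - A + i + j)
    have n2 := h.neg (A - i - x)
    rw [show -(B - A + i + j) = A - i - (B + j) by ring] at n1
    rw [show -(A - i - x) = x - (A - i) by ring] at n2
    have n3 := h.neg (B + j - x)
    rw [show -(B + j - x) = x - (B + j) by ring] at n3
    rw [n1, n2, n3, show A - i + (B + j) = A + B + j - i by ring,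
      show c + i + j - (A - i) = c - A + i + j + i by ring,
      show c + i + j + (A - i) = c + A + j by ring,
      show c + i + j - (B + j) = c - B + i by ring,
      show c + i + j + (B + j) = c + B + i + 2 * j by ring,
      show x + (B + j) = B + j + x by ring, show x + (A - i) = A - i + x by ring] at hp
    push_cast
    rw [show B - A + (i + j) = B - A + i + j by ring, show c + (i + j) - x = c + i + j - x by ring,
      show c + (i + j) + x = c + i + j + x by ring]
    generalize cu (c + B + i + 2 * j) = w at hp ⊢
    field_simp
    linear_combination -hp
  · simp [binomCoeff]
  · exact fun i hi => h.binomCoeff_succ_zero A B c i fun k hk => hcu k (by omega)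
  · exact fun j hj => h.binomCoeff_zero_succ A B c j fun k hk => hcu k (by omega)
  · exact fun i j hij => h.binomCoeff_succ_succ A B c i j fun k hk => hcu k (by omega)

variable {br cu W : ℂ → ℂ}

/-! ### The sum behind the braid relations -/

theorem Brackets.rising_neg (h : Brackets br cu) (x : ℂ) (n : ℕ) :
    rising br (1 + x - n) n = (-1) ^ n * rising br (-x) n := by
  rw [rising, rising, ← prod_range_reflect, ← card_range n, ← prod_const, card_range,
    ← prod_mul_distrib]
  refine prod_congr rfl fun l hl => ?_
  rw [mem_range] at hl
  rw [neg_one_mul, ← h.neg, Nat.sub_sub, Nat.cast_sub (by omega)]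
  push_cast
  ring_nf

/-- The coefficient of the shift by `a - 2 k` in the intertwining operator with parameter `a`,
for a function `W` with `W (x + 1) = {x} W x`. The ratio of values of `W` stands for
a product of values of `{·}` and for the prefactor of the operator. -/
def weight (br cu W : ℂ → ℂ) (k : ℕ) (a z : ℂ) : ℂ :=
  cu (z + a - 2 * k) * (W (z - k) / W (z + a - k + 1)) * (rising br (-a) k / rising br 1 k)

theorem rising_eq_div (hW : ∀ x, W x ≠ 0 → W (x + 1) ≠ 0 → W (x + 1) = cu x * W x) (x : ℂ) (n : ℕ)
    (hx : ∀ l : ℕ, l ≤ n → W (x + l) ≠ 0) : rising cu x n = W (x + n) / W x := by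
  induction n with
  | zero =>
    have := hx 0 le_rfl
    rw [Nat.cast_zero, add_zero] at this
    simp [this]
  | succ n ih =>
    have h0 := hx 0 (by omega)
    have h1 := hx n (by omega)
    have h2 := hx (n + 1) le_rfl
    rw [Nat.cast_zero, add_zero] at h0
    push_cast at h2 ⊢
    rw [← add_assoc] at h2 ⊢
    rw [rising_succ, ih fun l hl => hx l (by omega), hW _ h1 h2]
    ring

/-- A product of two weights is a binomial coefficient, up to a factor depending only on `i + j`;
the points `A`, `B`, `c` of the binomial theorem are chosen so. -/
theorem Brackets.weight_mul_weight (h : Brackets br cu)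
    (hW : ∀ x, W x ≠ 0 → W (x + 1) ≠ 0 → W (x + 1) = cu x * W x) (a b z : ℂ) (i j : ℕ)
    (h0 : ∀ k : ℤ, k.natAbs ≤ 2 * (i + j) + 1 → W (z + k) ≠ 0)
    (h1 : ∀ k : ℤ, k.natAbs ≤ 2 * (i + j) + 1 → W (z + a + k) ≠ 0)
    (h2 : ∀ k : ℤ, k.natAbs ≤ 2 * (i + j) + 1 → W (z + a + b + k) ≠ 0) :
    weight br cu W i a z * weight br cu W j b (z + a - 2 * i) =
      (-1) ^ (i + j) * (cu (z + a + b - 2 * (i + j)) * (W (z - (i + j)) /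
        (W (z + a + b - (i + j) + 1) * rising br 1 (i + j)))) *
      binomCoeff br cu ((z - 1 - b) / 2) ((z + 1 + 2 * a + b) / 2 - (i + j))
        ((z + 1 + b) / 2 - (i + j)) i j := by
  have R1 : rising cu (z + a + b + 1 - (i + j) - i) i =
      W (z + a + b - (i + j) + 1) / W (z + a + b + 1 - (i + j) - i) := by
    rw [rising_eq_div hW]
    · ring_nf
    · intro l hl
      have := h2 (1 - (i + j) - i + l) (by omega)
      push_cast at this
      convert this using 2; ring
  have R2 : rising cu (z - (i + j)) j = W (z - i) / W (z - (i + j)) := by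
    rw [rising_eq_div hW]
    · ring_nf
    · intro l hl
      have := h0 (- (i + j) + l) (by omega)
      push_cast at this
      convert this using 2; ring
  have R3 : rising cu (z + a - (i + j) - i) j = W (z + a - 2 * i) / W (z + a - (i + j) - i) := by
    rw [rising_eq_div hW]
    · ring_nf
    · intro l hl
      have := h1 (- (i + j) - i + l) (by omega)
      push_cast at this
      convert this using 2; ring
  have R4 : rising cu (z + a - 2 * i + 1) i = W (z + a - i + 1) / W (z + a - 2 * i + 1) := by
    rw [rising_eq_div hW]
    · ring_nf
    · intro l hl
      have := h1 (- 2 * i + 1 + l) (by omega)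
      push_cast at this
      convert this using 2; ring
  have w1 : W (z + a - 2 * i) ≠ 0 := by
    have := h1 (- 2 * i) (by omega)
    push_cast at this
    convert this using 2; ring
  have w2 : W (z + a - 2 * i + 1) ≠ 0 := by
    have := h1 (- 2 * i + 1) (by omega)
    push_cast at this
    convert this using 2; ring
  have w3 : W (z - (i + j)) ≠ 0 := by
    have := h0 (- (i + j)) (by omega)
    push_cast at this
    convert this using 2; ring
  have w4 : W (z + a + b - (i + j) + 1) ≠ 0 := by
    have := h2 (- (i + j) + 1) (by omega)
    push_cast at this
    convert this using 2; ring
  have w5 : W (z + a + b + 1 - (i + j) - i) ≠ 0 := by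
    have := h2 (1 - (i + j) - i) (by omega)
    push_cast at this
    convert this using 2; ring
  have w6 : W (z + a - (i + j) - i) ≠ 0 := by
    have := h1 (- (i + j) - i) (by omega)
    push_cast at this
    convert this using 2; ring
  have w7 : W (z + a - i + 1) ≠ 0 := by
    have := h1 (- i + 1) (by omega)
    push_cast at this
    convert this using 2; ring
  have C1 : cu (z + a - 2 * i) = W (z + a - 2 * i + 1) / W (z + a - 2 * i) := by
    rw [hW _ w1 w2, mul_div_cancel_right₀ _ w1]
  have f1 := h.rising_one_ne_zero i
  have f2 := h.rising_one_ne_zero j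
  have f3 := h.rising_one_ne_zero (i + j)
  have hneg := h.rising_neg b j
  rw [binomCoeff, weight, weight,
    show (z + 1 + b) / 2 - (i + j) - ((z + 1 + 2 * a + b) / 2 - (i + j)) = -a by ring,
    show (z + 1 + b) / 2 - (i + j) - (z - 1 - b) / 2 + i = 1 + b - j by ring,
    show (z + 1 + b) / 2 - (i + j) + ((z + 1 + 2 * a + b) / 2 - (i + j)) + j =
      z + a + b + 1 - (i + j) - i by ring,
    show (z + 1 + b) / 2 - (i + j) + (z - 1 - b) / 2 = z - (i + j) by ring,
    show (z - 1 - b) / 2 + ((z + 1 + 2 * a + b) / 2 - (i + j)) - i = z + a - (i + j) - i by ring,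
    show (z - 1 - b) / 2 + ((z + 1 + 2 * a + b) / 2 - (i + j)) + j - i + 1 =
      z + a - 2 * i + 1 by ring,
    show z + a - 2 * i + b - 2 * j = z + a + b - 2 * (i + j) by ring,
    show z + a - 2 * i - j = z + a - (i + j) - i by ring,
    show z + a - 2 * i + b - j + 1 = z + a + b + 1 - (i + j) - i by ring,
    R1, R2, R3, R4, C1, hneg]
  have hsgn : (-1 : ℂ) ^ (i + j) * ((-1) ^ i * (-1) ^ j) = 1 := by
    rw [← pow_add, ← mul_pow]; simp
  field_simp
  linear_combination (-(W (z - i) * rising br (-a) i *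
    (cu (z + a + b - 2 * (i + j)) * rising br (-b) j))) * hsgn

/-- The intertwining operator with parameter `0` is the identity. -/
theorem Brackets.weight_zero (h : Brackets br cu)
    (hW : ∀ x, W x ≠ 0 → W (x + 1) ≠ 0 → W (x + 1) = cu x * W x) (k : ℕ) {z : ℂ}
    (h0 : W z ≠ 0) (h1 : W (z + 1) ≠ 0) : weight br cu W k 0 z = if k = 0 then 1 else 0 := by
  rcases k with _ | k
  · have e := hW z h0 h1
    simp only [weight, Nat.cast_zero, mul_zero, sub_zero, add_zero, rising_zero, div_one, mul_one,
      if_true]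
    rw [← mul_div_assoc, ← e, div_self h1]
  · simp [weight, rising_succ_left, h.zero]

/-- Iteration of the functional equation of `g`. In `hg` the equation is required only between
non-zero values, since formulas for meromorphic `g` take junk values at their poles. -/
theorem prod_brackets_of_shift {g : ℂ → ℂ} {K x : ℂ}
    (hg : ∀ y, g y ≠ 0 → g (y + 2) ≠ 0 →
      g (y + 2) = K * (br (y / 2 - x) * cu (y / 2 + x)) * g y) (y : ℂ) (n : ℕ)
    (hy : ∀ l : ℕ, l ≤ n → g (y + 2 * l) ≠ 0) :
    g (y + 2 * n) =
      K ^ n * (∏ l ∈ range n, (br (y / 2 + l - x) * cu (y / 2 + l + x))) * g y := by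
  induction n with
  | zero => simp
  | succ n ih =>
    have h1 := hy n (by omega)
    have h2 := hy (n + 1) le_rfl
    push_cast at h2 ⊢
    rw [mul_add, ← add_assoc, mul_one] at h2 ⊢
    rw [hg _ h1 h2, ih fun l hl => hy l (by omega), prod_range_succ]
    ring_nf

/-- Equality of the coefficients of the two sides of a braid relation, for the intertwining
operators with coefficients `weight` and the multipliers `g (z + 1 + a) / g (z + 1 - a)`. By
iteration of `hg` both sides are sums of products over initial segments of `⟨A - l, x⟩`, `⟨B + l,
x⟩`, `⟨c + l, x⟩`, and the identity is `Brackets.binomial`. -/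
theorem Brackets.braid_sum (h : Brackets br cu)
    (hW : ∀ x, W x ≠ 0 → W (x + 1) ≠ 0 → W (x + 1) = cu x * W x) {g : ℂ → ℂ} {K x : ℂ}
    (hg : ∀ y, g y ≠ 0 → g (y + 2) ≠ 0 →
      g (y + 2) = K * (br (y / 2 - x) * cu (y / 2 + x)) * g y) (a b z : ℂ) (m : ℕ)
    (h0 : ∀ k : ℤ, k.natAbs ≤ 2 * m + 1 → W (z + k) ≠ 0)
    (h1 : ∀ k : ℤ, k.natAbs ≤ 2 * m + 1 → W (z + a + k) ≠ 0)
    (h2 : ∀ k : ℤ, k.natAbs ≤ 2 * m + 1 → W (z + a + b + k) ≠ 0)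
    (g0 : ∀ k : ℕ, k ≤ m → g (z + 1 + 2 * a + b - 2 * k) ≠ 0)
    (g1 : ∀ k : ℕ, k ≤ m → g (z + 1 - b - 2 * k) ≠ 0)
    (g2 : ∀ k : ℕ, k ≤ m → g (z + 1 + b - 2 * k) ≠ 0) :
    ∑ k ∈ HasAntidiagonal.antidiagonal m, weight br cu W k.1 a z *
        (g (z + 1 + 2 * a + b - 2 * k.1) / g (z + 1 - b - 2 * k.1)) *
        weight br cu W k.2 b (z + a - 2 * k.1) =
      g (z + 1 + b) / g (z + 1 - b) * weight br cu W m (a + b) z *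
        (g (z + 1 + 2 * a + b - 2 * m) / g (z + 1 + b - 2 * m)) := by
  set A := (z - 1 - b) / 2 with hA
  set B := (z + 1 + 2 * a + b) / 2 - m with hB
  set c := (z + 1 + b) / 2 - m with hc
  have hcu : ∀ k : ℤ, k.natAbs ≤ m → cu (A + B + k) ≠ 0 := by
    intro k hk e
    have e1 := h1 (-m + k) (by omega)
    have e2 := h1 (-m + k + 1) (by omega)
    push_cast at e1 e2
    rw [← add_assoc] at e2
    apply e2
    rw [hW _ e1 e2, show z + a + (-m + k) = A + B + k by rw [hA, hB]; ring, e, zero_mul]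
  -- the multipliers as products of linear factors, by the functional equation of `g`
  have hc0 : g (z + 1 + b) =
      K ^ m * (∏ l ∈ range m, (br (c + l - x) * cu (c + l + x))) * g (z + 1 + b - 2 * m) := by
    have := prod_brackets_of_shift hg (z + 1 + b - 2 * m) m fun l hl => by
      have := g2 (m - l) (by omega)
      rw [Nat.cast_sub hl] at this
      convert this using 2; ring
    rw [show (z + 1 + b - 2 * m) / 2 = c by rw [hc]; ring, sub_add_cancel] at this
    exact this
  have hterm : ∀ i j : ℕ, i + j = m →
      g (z + 1 + 2 * a + b - 2 * i) / g (z + 1 - b - 2 * i) =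
      K ^ m * (∏ l ∈ range i, (br (A - l - x) * cu (A - l + x))) *
        (∏ l ∈ range j, (br (B + l - x) * cu (B + l + x))) *
        (g (z + 1 + 2 * a + b - 2 * m) / g (z + 1 - b)) := by
    intro i j hij
    have hB0 := prod_brackets_of_shift hg (z + 1 + 2 * a + b - 2 * m) j fun l hl => by
      have := g0 (m - l) (by omega)
      rw [Nat.cast_sub (by omega)] at this
      convert this using 2; ring
    rw [show (z + 1 + 2 * a + b - 2 * m) / 2 = B by rw [hB]; ring,
      show z + 1 + 2 * a + b - 2 * m + 2 * j = z + 1 + 2 * a + b - 2 * i by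
        rw [← hij]; push_cast; ring] at hB0
    have hA0 := prod_brackets_of_shift hg (z + 1 - b - 2 * i) i fun l hl => by
      have := g1 (i - l) (by omega)
      rw [Nat.cast_sub (by omega)] at this
      convert this using 2; ring
    rw [sub_add_cancel, ← prod_range_reflect] at hA0
    have : ∏ l ∈ range i, (br ((z + 1 - b - 2 * i) / 2 + (i - 1 - l : ℕ) - x) *
        cu ((z + 1 - b - 2 * i) / 2 + (i - 1 - l : ℕ) + x)) =
        ∏ l ∈ range i, (br (A - l - x) * cu (A - l + x)) := by
      refine prod_congr rfl fun l hl => ?_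
      rw [mem_range] at hl
      rw [Nat.sub_sub, Nat.cast_sub (by omega),
        show (z + 1 - b - 2 * i) / 2 + (i - (1 + l : ℕ)) = A - l by rw [hA]; push_cast; ring]
    rw [this] at hA0
    have e1 := g1 0 (by omega)
    have e2 := g1 i (by omega)
    rw [Nat.cast_zero, mul_zero, sub_zero] at e1
    rw [hB0, div_eq_iff e2, ← hij, pow_add]
    field_simp
    rw [hA0]
    ring
  have hsum := h.binomial A B c x m hcu
  have e0 := g2 m le_rfl
  have e1 := g1 0 (by omega)
  rw [Nat.cast_zero, mul_zero, sub_zero] at e1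
  have hBA : rising br (B - A) m = (-1) ^ m * rising br (-(a + b)) m := by
    rw [← h.rising_neg, hA, hB]; ring_nf
  calc _ = ∑ k ∈ HasAntidiagonal.antidiagonal m, K ^ m *
        (g (z + 1 + 2 * a + b - 2 * m) / g (z + 1 - b)) *
        ((-1) ^ m * (cu (z + a + b - 2 * m) * (W (z - m) /
        (W (z + a + b - m + 1) * rising br 1 m)))) * (binomCoeff br cu A B c k.1 k.2 *
        (∏ l ∈ range k.1, (br (A - l - x) * cu (A - l + x))) *
        ∏ l ∈ range k.2, (br (B + l - x) * cu (B + l + x))) := by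
        refine sum_congr rfl fun k hk => ?_
        rw [HasAntidiagonal.mem_antidiagonal] at hk
        rw [hterm k.1 k.2 hk]
        have := h.weight_mul_weight hW a b z k.1 k.2 (by rwa [hk]) (by rwa [hk]) (by rwa [hk])
        rw [← Nat.cast_add, hk, ← hA, ← hB, ← hc] at this
        linear_combination (K ^ m * (∏ l ∈ range k.1, (br (A - l - x) * cu (A - l + x))) *
          (∏ l ∈ range k.2, (br (B + l - x) * cu (B + l + x))) *
          (g (z + 1 + 2 * a + b - 2 * m) / g (z + 1 - b))) * this
    _ = _ := by
        rw [← mul_sum, ← hsum, hBA, hc0, weight, ← add_assoc]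
        have : ((-1 : ℂ) ^ m) * (-1) ^ m = 1 := by rw [← mul_pow]; simp
        have e := mul_div_cancel₀ (g (z + 1 + 2 * a + b - 2 * m)) e0
        linear_combination
          (K ^ m * (g (z + 1 + 2 * a + b - 2 * m) / g (z + 1 - b)) * (cu (z + a + b - 2 * m) *
            (W (z - m) / (W (z + a + b - m + 1) * rising br 1 m))) * rising br (-(a + b)) m *
            (∏ l ∈ range m, (br (c + l - x) * cu (c + l + x)))) * this -
          (K ^ m * (∏ l ∈ range m, (br (c + l - x) * cu (c + l + x))) / g (z + 1 - b) *
            (cu (z + a + b - 2 * m) * (W (z - m) / W (z + a + b - m + 1)) *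
              (rising br (-(a + b)) m / rising br 1 m))) * e

/-! ### Taylor coefficients -/

theorem taylorCoeff_of_hasFPowerSeriesAt {f : ℂ → ℂ} {c : ℕ → ℂ}
    (h : HasFPowerSeriesAt f (FormalMultilinearSeries.ofScalars ℂ c) 0) (k : ℕ) :
    taylorCoeff f k = c k := by
  obtain ⟨r, hr⟩ := h
  have := hr.factorial_smul 1 k
  rw [FormalMultilinearSeries.ofScalars_apply_eq, one_pow, smul_eq_mul, mul_one,
    nsmul_eq_mul] at this
  rw [taylorCoeff, iteratedDeriv_eq_iteratedFDeriv, ← this,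
    mul_div_cancel_left₀ _ (by exact_mod_cast k.factorial_ne_zero)]

theorem taylorCoeff_one_sub_cpow_eq_choose (a : ℂ) (k : ℕ) :
    taylorCoeff (fun t => (1 - t) ^ a) k = (-1) ^ k * Ring.choose a k := by
  have := iteratedDeriv_comp_neg k (fun t : ℂ => (1 + t) ^ a) 0
  simp only [← sub_eq_add_neg, neg_zero, smul_eq_mul] at this
  rw [← taylorCoeff_of_hasFPowerSeriesAt one_add_cpow_hasFPowerSeriesAt_zero, taylorCoeff, this,
    taylorCoeff, mul_div_assoc]

theorem taylorCoeff_one_sub_cpow (a : ℂ) (k : ℕ) :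
    taylorCoeff (fun t => (1 - t) ^ a) k = rising id (-a) k / rising id 1 k := by
  have h2 : rising id 1 k = k.factorial := by
    rw [← Finset.prod_range_add_one_eq_factorial, rising]
    push_cast
    exact prod_congr rfl fun l _ => add_comm _ _
  have h3 : ∀ k, (descPochhammer ℤ k).smeval a = (-1) ^ k * rising id (-a) k := by
    intro k
    induction k with
    | zero => simp
    | succ k ih =>
      rw [descPochhammer_succ_right, Polynomial.smeval_mul, ih, rising_succ]
      simp [Polynomial.smeval_sub, Polynomial.smeval_natCast, pow_succ]
      ring
  have hsgn : (-1 : ℂ) ^ k * (-1) ^ k = 1 := by rw [← mul_pow]; simp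
  have hf : (k.factorial : ℂ) ≠ 0 := by exact_mod_cast k.factorial_ne_zero
  rw [taylorCoeff_one_sub_cpow_eq_choose, Ring.choose_eq_smul, h3, h2, smul_eq_mul]
  field_simp
  linear_combination (rising id (-a) k) * hsgn

/-! ### Zeros of infinite products -/

theorem tprod_one_sub_ne_zero_generic {ι : Type*} [Countable ι] {e : ι → ℂ} (he : Summable e)
    (h0 : ∀ i, e i ≠ 0) : ∀ᶠ w in generic ℂ, ∏' i, (1 - e i * w) ≠ 0 := by
  let _ : TopologicalSpace ι := ⊥
  have : DiscreteTopology ι := ⟨rfl⟩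
  have hlim : Tendsto (fun i => (e i)⁻¹) (cocompact ι) (cocompact ℂ) := by
    rw [cocompact_eq_cofinite]
    have : Tendsto e cofinite (nhdsWithin 0 {0}ᶜ) :=
      tendsto_nhdsWithin_iff.2 ⟨he.tendsto_cofinite_zero, Eventually.of_forall h0⟩
    rw [← Metric.cobounded_eq_cocompact]
    exact tendsto_inv₀_nhdsNE_zero.comp this
  have hcl : IsClosed (Set.range fun i => (e i)⁻¹) :=
    (isProperMap_iff_tendsto_cocompact.2 ⟨continuous_of_discreteTopology, hlim⟩).isClosed_range
  have hd : Dense (Set.range fun i => (e i)⁻¹)ᶜ := (Set.countable_range _).dense_compl ℝ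
  filter_upwards [mem_generic_of_isOpen hcl.isOpen_compl hd] with w hw
  have := tprod_one_add_ne_zero_of_summable (f := fun i => -(e i * w)) (fun i hi => hw ⟨i, ?_⟩)
    (he.mul_right w).norm.of_norm.neg.norm
  · simpa [sub_eq_add_neg] using this
  · have : e i * w = 1 := by linear_combination -hi
    exact inv_eq_of_mul_eq_one_right this

theorem multipliable_one_sub {ι : Type*} {e : ι → ℂ} (he : Summable e) (w : ℂ) :
    Multipliable fun i => 1 - e i * w := by
  simpa [sub_eq_add_neg] using
    Complex.multipliable_one_add_of_summable (he.mul_right w).neg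

theorem tendsto_generic_exp {c : ℂ} (hc : c ≠ 0) :
    Tendsto (fun z => exp (c * z)) (generic ℂ) (generic ℂ) :=
  tendsto_generic (by fun_prop) (isOpenMap_exp.comp ((Homeomorph.mulLeft₀ c hc).isOpenMap))

/-! ### Power series in `z₁ / z₂` -/

namespace EulerSeries

theorem equiv_iff {A B : EulerSeries} :
    A ≈ B ↔ A.lead = B.lead ∧ ∀ n, A.coeff n =ᶠ[generic (ℂ × ℂ)] B.coeff n :=
  and_congr_right fun _ => forall_congr' fun _ => merEq_iff

theorem mul_lead (A B : EulerSeries) : (A * B).lead = A.lead + B.lead := rfl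

theorem mul_coeff (A B : EulerSeries) (n : ℕ) (d : ℂ × ℂ) :
    (A * B).coeff n d = ∑ p ∈ antidiagonal n,
      A.coeff p.1 (d + B.lead + ((p.2 : ℂ), -(p.2 : ℂ))) * B.coeff p.2 d := rfl

theorem mul_single_coeff (A : EulerSeries) (α : ℂ × ℂ) (f : ℂ × ℂ → ℂ) (n : ℕ) (d : ℂ × ℂ) :
    (A * single α f).coeff n d = A.coeff n (d + α) * f d := by
  simp only [mul_coeff, single, mul_ite, mul_zero]
  rw [sum_antidiagonal_ite_snd]
  simp [Prod.mk_zero_zero]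

theorem single_mul_coeff (A : EulerSeries) (α : ℂ × ℂ) (f : ℂ × ℂ → ℂ) (n : ℕ) (d : ℂ × ℂ) :
    (single α f * A).coeff n d = f (d + A.lead + ((n : ℂ), -(n : ℂ))) * A.coeff n d := by
  simp only [mul_coeff, single, ite_mul, zero_mul]
  rw [sum_antidiagonal_ite_fst]

end EulerSeries

/-! ### No deformation -/

/-- The additive brackets `[x] = x`, `{x} = 1`. -/
theorem brackets_rational : Brackets id (fun _ => 1) where
  neg _ := rfl
  nat_ne_zero k := Nat.cast_add_one_ne_zero k
  plucker x y u v := by simp only [id]; ring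
  pascal N M P k := by simp only [id]; ring

theorem weight_rational (k : ℕ) (a z : ℂ) :
    weight id (fun _ => 1) (fun _ => 1) k a z = taylorCoeff (fun t => (1 - t) ^ a) k := by
  rw [taylorCoeff_one_sub_cpow, weight]
  simp

/-- The Pfaff–Saalschütz sum, as `Brackets.braid_sum` for the additive brackets and `W = 1`: here
the weights are the coefficients of `S₂`, and `g` comes from the Gamma quotients in `S₁`, `S₃`. -/
theorem rational_braid_sum {g : ℂ → ℂ} {K x : ℂ}
    (hg : ∀ y, g y ≠ 0 → g (y + 2) ≠ 0 → g (y + 2) = K * (y / 2 - x) * g y) (a b z : ℂ) (m : ℕ)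
    (g0 : ∀ k : ℕ, k ≤ m → g (z + 1 + 2 * a + b - 2 * k) ≠ 0)
    (g1 : ∀ k : ℕ, k ≤ m → g (z + 1 - b - 2 * k) ≠ 0)
    (g2 : ∀ k : ℕ, k ≤ m → g (z + 1 + b - 2 * k) ≠ 0) :
    ∑ k ∈ antidiagonal m, taylorCoeff (fun t => (1 - t) ^ a) k.1 *
        (g (z + 1 + 2 * a + b - 2 * k.1) / g (z + 1 - b - 2 * k.1)) *
        taylorCoeff (fun t => (1 - t) ^ b) k.2 =
      g (z + 1 + b) / g (z + 1 - b) * taylorCoeff (fun t => (1 - t) ^ (a + b)) m *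
        (g (z + 1 + 2 * a + b - 2 * m) / g (z + 1 + b - 2 * m)) := by
  have := brackets_rational.braid_sum (W := fun _ => 1) (by simp) (g := g) (K := K) (x := x)
    (by simpa using hg) a b z m (by simp) (by simp) (by simp) g0 g1 g2
  simpa only [weight_rational] using this

theorem Gamma_add_int_ne_zero {z : ℂ} (hz : z ∉ Set.range ((↑) : ℤ → ℂ)) (k : ℤ) :
    Gamma (z + k) ≠ 0 :=
  Gamma_ne_zero fun n hn => hz ⟨-n - k, by push_cast; linear_combination -hn⟩

theorem not_int_generic : ∀ᶠ z in generic ℂ, z ∉ Set.range ((↑) : ℤ → ℂ) :=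
  mem_generic_of_isOpen isClosed_range_intCast.isOpen_compl
    ((Set.countable_range _).dense_compl ℝ)

namespace Undeformed

open EulerSeries

theorem gammaRatio_mul (a : ℂ) :
    ∀ᶠ d in generic ℂ, gammaRatio (-a) (d - a) * gammaRatio a d = 1 := by
  filter_upwards [not_int_generic,
    (tendsto_generic_affine₁ one_ne_zero (-a)).eventually not_int_generic] with d h0 h1
  have e0 := Gamma_add_int_ne_zero h0 1
  have e1 := Gamma_add_int_ne_zero h1 1
  push_cast at e0 e1
  rw [gammaRatio, gammaRatio, show d - a + 1 - -a = d + 1 by ring,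
    show d + 1 - a = d - a + 1 by ring, show d - a + 1 = 1 * d + -a + 1 by ring,
    div_mul_div_cancel₀ e0, div_self e1]

theorem S₁_inv (a : ℂ) : S₁ (-a) * S₁ a ≈ 1 := by
  refine equiv_iff.2 ⟨by simp [S₁, single, mul_lead]; rfl, fun n => ?_⟩
  filter_upwards [tendsto_generic_fst.eventually (gammaRatio_mul a)] with d hd
  rw [S₁, S₁, mul_single_coeff]
  change (if _ then _ else _) * _ = if _ then _ else _
  split_ifs
  · rw [← hd]; simp [sub_eq_add_neg]
  · simp

theorem S₃_inv (a : ℂ) : S₃ (-a) * S₃ a ≈ 1 := by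
  refine equiv_iff.2 ⟨by simp [S₃, single, mul_lead]; rfl, fun n => ?_⟩
  filter_upwards [tendsto_generic_snd.eventually (gammaRatio_mul a)] with d hd
  rw [S₃, S₃, mul_single_coeff]
  change (if _ then _ else _) * _ = if _ then _ else _
  split_ifs
  · rw [← hd]; simp [sub_eq_add_neg]
  · simp

theorem S₁_comm_S₃ (a b : ℂ) : S₁ a * S₃ b ≈ S₃ b * S₁ a := by
  refine equiv_iff.2 ⟨by simp [S₁, S₃, single, mul_lead], fun n => ?_⟩
  refine Eventually.of_forall fun d => ?_
  rw [S₁, S₃, mul_single_coeff, mul_single_coeff]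
  simp only [single]
  split_ifs <;> simp [mul_comm]

/-- The roles of the operators are exchanged compared with the deformed cases: the products of
two `S₂` are on the right side, where the sum is. -/
theorem braid₁ (a b : ℂ) : S₁ a * S₂ (a + b) * S₁ b ≈ S₂ b * S₁ (a + b) * S₂ a := by
  refine equiv_iff.2 ⟨by ext <;> simp [S₁, S₂, single, mul_lead] <;> ring, fun n => ?_⟩
  have hg : ∀ y : ℂ, (Gamma (1 - y / 2))⁻¹ ≠ 0 → (Gamma (1 - (y + 2) / 2))⁻¹ ≠ 0 →
      (Gamma (1 - (y + 2) / 2))⁻¹ = -1 * (y / 2 - 0) * (Gamma (1 - y / 2))⁻¹ := by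
    intro y _ _
    have := Complex.one_div_Gamma_eq_self_mul_one_div_Gamma_add_one (-(y / 2))
    rw [show 1 - (y + 2) / 2 = -(y / 2) by ring, show 1 - y / 2 = -(y / 2) + 1 by ring]
    rw [this]; ring
  filter_upwards [tendsto_generic_fst.eventually not_int_generic,
    tendsto_generic_fst.eventually ((tendsto_generic_affine₁ one_ne_zero (-a - b)).eventually
      not_int_generic),
    tendsto_generic_fst.eventually ((tendsto_generic_affine₁ one_ne_zero (-b)).eventually
      not_int_generic)] with d h0 h1 h2
  -- the point at which the multipliers become the Gamma quotients of the three factors `S₁`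
  have key := rational_braid_sum hg a b (b - 1 - 2 * d.1) n
    (fun k _ => inv_ne_zero (by
      have := Gamma_add_int_ne_zero h1 (1 + k)
      push_cast at this
      convert this using 2; ring))
    (fun k _ => inv_ne_zero (by
      have := Gamma_add_int_ne_zero h0 (1 + k)
      push_cast at this
      convert this using 2; ring))
    (fun k _ => inv_ne_zero (by
      have := Gamma_add_int_ne_zero h2 (1 + k)
      push_cast at this
      convert this using 2; ring))
  rw [S₁, S₁, mul_single_coeff, single_mul_coeff, mul_coeff, S₁]
  simp only [mul_single_coeff]
  rw [← Nat.sum_antidiagonal_swap]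
  simp only [show ∀ k : ℂ, 1 - (b - 1 - 2 * d.1 + 1 + 2 * a + b - 2 * k) / 2 =
      d.1 + k + 1 - (a + b) by intro k; ring,
    show ∀ k : ℂ, 1 - (b - 1 - 2 * d.1 + 1 - b - 2 * k) / 2 = d.1 + k + 1 by intro k; ring,
    show ∀ k : ℂ, 1 - (b - 1 - 2 * d.1 + 1 + b - 2 * k) / 2 = d.1 - b + k + 1 by intro k; ring,
    show 1 - (b - 1 - 2 * d.1 + 1 + b) / 2 = d.1 + 1 - b by ring,
    show 1 - (b - 1 - 2 * d.1 + 1 - b) / 2 = d.1 + 1 by ring, inv_div_inv] at key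
  simp only [S₂, gammaRatio, Prod.swap, Prod.fst_add, ← sub_eq_add_neg, add_zero]
  refine Eq.trans ?_ (key.symm.trans (sum_congr rfl fun k _ => by ring))
  rw [show d.1 - b + n + 1 - a = d.1 + n + 1 - (a + b) by ring]
  ring

theorem braid₂ (a b : ℂ) : S₂ a * S₃ (a + b) * S₂ b ≈ S₃ b * S₂ (a + b) * S₃ a := by
  refine equiv_iff.2 ⟨by ext <;> simp [S₃, S₂, single, mul_lead], fun n => ?_⟩
  have hg : ∀ y : ℂ, Gamma (y / 2) ≠ 0 → Gamma ((y + 2) / 2) ≠ 0 →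
      Gamma ((y + 2) / 2) = 1 * (y / 2 - 0) * Gamma (y / 2) := by
    intro y hy _
    rw [show (y + 2) / 2 = y / 2 + 1 by ring, Gamma_add_one]
    · ring
    · intro h
      rw [h, Gamma_zero] at hy
      exact hy rfl
  filter_upwards [tendsto_generic_snd.eventually not_int_generic,
    tendsto_generic_snd.eventually ((tendsto_generic_affine₁ one_ne_zero (-a)).eventually
      not_int_generic),
    tendsto_generic_snd.eventually ((tendsto_generic_affine₁ one_ne_zero b).eventually
      not_int_generic)] with d h0 h1 h2
  have key := rational_braid_sum hg b a (2 * d.2 + 1 - a) n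
    (fun k _ => by
      have := Gamma_add_int_ne_zero h2 (1 - k)
      push_cast at this
      convert this using 2; ring)
    (fun k _ => by
      have := Gamma_add_int_ne_zero h1 (1 - k)
      push_cast at this
      convert this using 2; ring)
    (fun k _ => by
      have := Gamma_add_int_ne_zero h0 (1 - k)
      push_cast at this
      convert this using 2; ring)
  rw [S₃, S₃, S₃, mul_single_coeff, single_mul_coeff, mul_coeff]
  simp only [mul_single_coeff]
  rw [← Nat.sum_antidiagonal_swap]
  simp only [show ∀ k : ℂ, (2 * d.2 + 1 - a + 1 + 2 * b + a - 2 * k) / 2 =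
      d.2 + b - k + 1 by intro k; ring,
    show ∀ k : ℂ, (2 * d.2 + 1 - a + 1 - a - 2 * k) / 2 = d.2 + b - k + 1 - (a + b) by
      intro k; ring,
    show ∀ k : ℂ, (2 * d.2 + 1 - a + 1 + a - 2 * k) / 2 = d.2 + b - n + 1 - b + n - k by
      intro k; ring,
    show (2 * d.2 + 1 - a + 1 + a) / 2 = d.2 + 1 by ring,
    show (2 * d.2 + 1 - a + 1 - a) / 2 = d.2 + 1 - a by ring, add_sub_cancel_right] at key
  simp only [S₂, gammaRatio, Prod.swap, Prod.snd_add, ← sub_eq_add_neg]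
  rw [show d.2 - a + (a + b) - n + 1 = d.2 + b - n + 1 by ring, add_comm a b]
  rw [add_comm a b] at key
  refine Eq.trans (sum_congr rfl fun k _ => by ring) (key.trans (by ring))

/-- The Chu–Vandermonde identity. -/
theorem S₂_inv (a : ℂ) : S₂ (-a) * S₂ a ≈ 1 := by
  refine equiv_iff.2 ⟨by simp [S₂, mul_lead]; rfl, fun n => ?_⟩
  filter_upwards with d
  change ∑ p ∈ antidiagonal n, taylorCoeff (fun t => (1 - t) ^ (-a)) p.1 *
    taylorCoeff (fun t => (1 - t) ^ a) p.2 = if n = 0 then 1 else 0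
  have : ∀ p ∈ antidiagonal n, taylorCoeff (fun t => (1 - t) ^ (-a)) p.1 *
      taylorCoeff (fun t => (1 - t) ^ a) p.2 =
      (-1) ^ n * (Ring.choose (-a) p.1 * Ring.choose a p.2) := by
    intro p hp
    rw [HasAntidiagonal.mem_antidiagonal] at hp
    rw [taylorCoeff_one_sub_cpow_eq_choose, taylorCoeff_one_sub_cpow_eq_choose, ← hp, pow_add]
    ring
  rw [sum_congr rfl this, ← mul_sum, ← Ring.add_choose_eq _ (Commute.all _ _), neg_add_cancel,
    Ring.choose_zero_ite]
  split_ifs with h <;> simp [h]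

theorem coxeterRelations : CoxeterRelations S₁ S₂ S₃ :=
  ⟨S₁_inv, S₂_inv, S₃_inv, S₁_comm_S₃, braid₁, braid₂⟩

end Undeformed

/-! ### Quantum deformation -/

namespace Quantum

theorem qpow_add (h u v : ℂ) : qpow h (u + v) = qpow h u * qpow h v := by
  rw [qpow, add_mul, exp_add]; rfl

theorem qpow_ne_zero (h u : ℂ) : qpow h u ≠ 0 := exp_ne_zero _

theorem qpow_neg (h u : ℂ) : qpow h (-u) = (qpow h u)⁻¹ := by
  rw [qpow, neg_mul, exp_neg]; rfl

theorem qpow_sub (h u v : ℂ) : qpow h (u - v) = qpow h u / qpow h v := by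
  rw [sub_eq_add_neg, qpow_add, qpow_neg]; rfl

@[simp] theorem qpow_zero (h : ℂ) : qpow h 0 = 1 := by simp [qpow]

theorem qpow_mul_natCast (h u : ℂ) (k : ℕ) : qpow h (u * k) = qpow h u ^ k := by
  rw [qpow, qpow, ← exp_nat_mul]; ring_nf

theorem norm_qpow_two_lt_one {h : ℂ} (hh : h.re < 0) : ‖qpow h 2‖ < 1 := by
  rw [qpow, norm_exp, Real.exp_lt_one_iff]
  simp
  linarith

/-- The bracket `[x] = q^x - q^(-x)`. -/
def qbr (h x : ℂ) : ℂ := qpow h x - qpow h (-x)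

/-- The companion `{x} = q^(-x - 1/2)` of the bracket `[x] = q^x - q^(-x)`. The normalization is
the one for which `qgauss` satisfies `W (x + 1) = {x} W x`. -/
def qcu (h x : ℂ) : ℂ := qpow h (-x - 1 / 2)

/-- The Gaussian `W(x) = q^(-x²/2)`. -/
def qgauss (h x : ℂ) : ℂ := qpow h (-(x ^ 2 / 2))

theorem qbr_mul_qcu (h x y : ℂ) :
    qbr h (x - y) * qcu h (x + y) = qpow h (-1 / 2) * (qpow h (-2 * y) - qpow h (-2 * x)) := by
  rw [qbr, qcu, sub_mul, mul_sub, ← qpow_add, ← qpow_add, ← qpow_add, ← qpow_add]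
  ring_nf

theorem brackets_qbr {h : ℂ} (hh : h.re < 0) : Brackets (qbr h) (qcu h) where
  neg x := by rw [qbr, qbr]; ring_nf
  nat_ne_zero k hk := by
    have h1 : qpow h 2 ^ (k + 1) = 1 := by
      rw [← qpow_mul_natCast, show (2 : ℂ) * (k + 1 : ℕ) = (k + 1) - -(k + 1) by push_cast; ring,
        qpow_sub, sub_eq_zero.1 hk, div_self (qpow_ne_zero _ _)]
    have h2 := pow_lt_one₀ (norm_nonneg _) (norm_qpow_two_lt_one hh) k.succ_ne_zero
    rw [← norm_pow, h1, norm_one] at h2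
    exact lt_irrefl _ h2
  plucker x y u v := by simp only [qbr_mul_qcu]; ring
  pascal N M P k := by
    have hN := qpow_ne_zero h N
    have hM := qpow_ne_zero h M
    have hP := qpow_ne_zero h P
    have hk := qpow_ne_zero h k
    have hl := qpow_ne_zero h (1 / 2)
    simp only [qbr, qcu, qpow_sub, qpow_add, qpow_neg, two_mul]
    field_simp
    ring

theorem qgauss_add_one (h x : ℂ) : qgauss h (x + 1) = qcu h x * qgauss h x := by
  rw [qgauss, qgauss, qcu, ← qpow_add]; ring_nf

theorem qgauss_ne_zero (h x : ℂ) : qgauss h x ≠ 0 := qpow_ne_zero _ _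

/-! ### The `q`-binomial theorem -/

/-- The Taylor coefficients of `qRatio`, as given by the `q`-binomial theorem. -/
def qTaylor (h a : ℂ) (k : ℕ) : ℂ :=
  qpow h ((1 - a) * k) * (rising (qbr h) (-a) k / rising (qbr h) 1 k)

theorem qTaylor_zero (h a : ℂ) : qTaylor h a 0 = 1 := by simp [qTaylor]

theorem qTaylor_succ {h : ℂ} (hh : h.re < 0) (a : ℂ) (k : ℕ) :
    qTaylor h a (k + 1) * (1 - qpow h 2 ^ (k + 1)) =
      (qpow h 2 - qpow h (2 - 2 * a) * qpow h 2 ^ k) * qTaylor h a k := by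
  have hB := brackets_qbr hh
  have h1 : 1 - qpow h 2 ^ (k + 1) = - (qpow h (k + 1) * qbr h (1 + k)) := by
    rw [← qpow_mul_natCast, qbr, mul_sub, ← qpow_add, ← qpow_add]
    push_cast
    ring_nf
    simp
    ring
  have h2 : qpow h 2 - qpow h (2 - 2 * a) * qpow h 2 ^ k =
      - (qpow h (2 + k - a) * qbr h (-a + k)) := by
    rw [← qpow_mul_natCast, qbr, mul_sub, ← qpow_add, ← qpow_add, ← qpow_add]
    ring_nf
  have h3 : qpow h ((1 - a) * (k + 1 : ℕ)) * qpow h (k + 1) =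
      qpow h (2 + k - a) * qpow h ((1 - a) * k) := by
    rw [← qpow_add, ← qpow_add]; push_cast; ring_nf
  have e1 := hB.rising_one_ne_zero k
  have e2 := hB.nat_ne_zero k
  rw [add_comm] at e2
  rw [h1, h2, qTaylor, qTaylor, rising_succ, rising_succ]
  field_simp
  linear_combination (- (rising (qbr h) (-a) k * qbr h (-a + k))) * h3

/-- The series with coefficients `qTaylor` has a positive radius of convergence. -/
theorem exists_norm_qTaylor_le {h : ℂ} (hh : h.re < 0) (a : ℂ) :
    ∃ C : ℝ, 0 < C ∧ ∀ k, ‖qTaylor h a k‖ ≤ C ^ k := by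
  have hq := norm_qpow_two_lt_one hh
  refine ⟨(1 + ‖qpow h (2 - 2 * a)‖) / (1 - ‖qpow h 2‖),
    div_pos (by positivity) (by linarith), fun k => ?_⟩
  induction k with
  | zero => simp [qTaylor_zero]
  | succ k ih =>
    have hs := congrArg norm (qTaylor_succ hh a k)
    rw [norm_mul, norm_mul] at hs
    have hp : ‖qpow h 2‖ ^ k ≤ 1 := pow_le_one₀ (norm_nonneg _) hq.le
    have h1 : 1 - ‖qpow h 2‖ ≤ ‖1 - qpow h 2 ^ (k + 1)‖ := by
      have := norm_sub_norm_le 1 (qpow h 2 ^ (k + 1))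
      rw [norm_one, norm_pow, pow_succ] at this
      nlinarith [norm_nonneg (qpow h 2)]
    have h2 : ‖qpow h 2 - qpow h (2 - 2 * a) * qpow h 2 ^ k‖ ≤ 1 + ‖qpow h (2 - 2 * a)‖ := by
      refine (norm_sub_le _ _).trans ?_
      rw [norm_mul, norm_pow]
      nlinarith [norm_nonneg (qpow h (2 - 2 * a))]
    rw [pow_succ, mul_div_assoc', le_div_iff₀ (by linarith)]
    calc ‖qTaylor h a (k + 1)‖ * (1 - ‖qpow h 2‖)
        ≤ ‖qTaylor h a (k + 1)‖ * ‖1 - qpow h 2 ^ (k + 1)‖ := by gcongr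
      _ = ‖qpow h 2 - qpow h (2 - 2 * a) * qpow h 2 ^ k‖ * ‖qTaylor h a k‖ := hs
      _ ≤ (1 + ‖qpow h (2 - 2 * a)‖) * ((1 + ‖qpow h (2 - 2 * a)‖) / (1 - ‖qpow h 2‖)) ^ k := by
        gcongr
      _ = _ := mul_comm _ _

theorem summable_qpow_two_mul {h : ℂ} (hh : h.re < 0) : Summable fun k : ℕ => qpow h (2 * k) := by
  simp only [qpow_mul_natCast]
  exact summable_geometric_of_norm_lt_one (norm_qpow_two_lt_one hh)

theorem multipliable_qProd {h : ℂ} (hh : h.re < 0) (x : ℂ) :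
    Multipliable fun k : ℕ => 1 - x * qpow h (2 * k) := by
  simpa only [mul_comm] using multipliable_one_sub (summable_qpow_two_mul hh) x

theorem qProd_eq_mul {h : ℂ} (hh : h.re < 0) (x : ℂ) :
    qProd h x = (1 - x) * qProd h (qpow h 2 * x) := by
  have e : ∀ k : ℕ, 1 - x * qpow h (2 * (k + 1 : ℕ)) = 1 - qpow h 2 * x * qpow h (2 * k) := by
    intro k
    rw [show (2 : ℂ) * (k + 1 : ℕ) = 2 + 2 * k by push_cast; ring, qpow_add]
    ring
  rw [qProd, tprod_eq_zero_mul']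
  · simp only [e]
    simp [qProd]
  · simp only [e]
    exact multipliable_qProd hh _

theorem qProd_ne_zero_generic {h : ℂ} (hh : h.re < 0) : ∀ᶠ w in generic ℂ, qProd h w ≠ 0 := by
  filter_upwards [tprod_one_sub_ne_zero_generic (summable_qpow_two_mul hh) fun k =>
    qpow_ne_zero h _] with w hw
  simpa only [qProd, mul_comm w] using hw

theorem qProd_ne_zero_of_norm_lt_one {h : ℂ} (hh : h.re < 0) {w : ℂ} (hw : ‖w‖ < 1) :
    qProd h w ≠ 0 := by
  have := tprod_one_add_ne_zero_of_summable (f := fun k : ℕ => -(w * qpow h (2 * k)))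
    (fun k e => ?_) ((summable_qpow_two_mul hh).mul_left w).neg.norm
  · simpa only [qProd, ← sub_eq_add_neg] using this
  · have h1 : w * qpow h (2 * k) = 1 := by linear_combination -e
    have h2 := congrArg norm h1
    rw [norm_mul, qpow_mul_natCast, norm_pow, norm_one] at h2
    have h3 : ‖qpow h 2‖ ^ k ≤ 1 := pow_le_one₀ (norm_nonneg _) (norm_qpow_two_lt_one hh).le
    nlinarith [norm_nonneg w, norm_nonneg (qpow h 2 ^ k)]

/-- The `q`-binomial theorem: the recursion `qTaylor_succ` is a functional equation relating the
values of the sum at `w` and `q² w`, and its iteration gives the quotient of infinite products. -/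
theorem qRatio_hasFPowerSeriesAt {h : ℂ} (hh : h.re < 0) (a : ℂ) :
    HasFPowerSeriesAt (qRatio h a) (FormalMultilinearSeries.ofScalars ℂ (qTaylor h a)) 0 := by
  obtain ⟨C, hC, hle⟩ := exists_norm_qTaylor_le hh a
  have hq := norm_qpow_two_lt_one hh
  set p := FormalMultilinearSeries.ofScalars ℂ (qTaylor h a) with hp
  let r : NNReal := Real.toNNReal C⁻¹
  have hr : (r : ENNReal) ≤ p.radius := by
    refine p.le_radius_of_bound 1 fun n => ?_
    rw [hp, FormalMultilinearSeries.ofScalars_norm]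
    rw [Real.coe_toNNReal _ (inv_pos.2 hC).le]
    calc _ ≤ C ^ n * (C⁻¹) ^ n := by gcongr; exact hle n
      _ = 1 := by rw [← mul_pow, mul_inv_cancel₀ hC.ne', one_pow]
  have hr0 : 0 < (r : ENNReal) := by
    rw [ENNReal.coe_pos]; exact Real.toNNReal_pos.2 (inv_pos.2 hC)
  have hball := (p.hasFPowerSeriesOnBall (hr0.trans_le hr))
  have hsum : ∀ w : ℂ, ‖w‖ < C⁻¹ → HasSum (fun k => qTaylor h a k * w ^ k) (p.sum w) := by
    intro w hw
    have := hball.hasSum (y := w) (by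
      refine Metric.eball_subset_eball hr ?_
      rw [Metric.mem_eball, edist_zero_right, ← ofReal_norm]
      exact (ENNReal.ofReal_lt_ofReal_iff (inv_pos.2 hC)).2 hw)
    simpa only [hp, FormalMultilinearSeries.ofScalars_apply_eq, smul_eq_mul, zero_add] using this
  have hfun : ∀ w : ℂ, ‖w‖ < C⁻¹ →
      p.sum w * (1 - qpow h 2 * w) = (1 - qpow h (2 - 2 * a) * w) * p.sum (qpow h 2 * w) := by
    intro w hw
    have hw' : ‖qpow h 2 * w‖ < C⁻¹ := by
      rw [norm_mul]; nlinarith [norm_nonneg w]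
    have s1 := hsum w hw
    have s2 := hsum _ hw'
    have s3 := (hasSum_nat_add_iff' 1).2 (s1.sub s2)
    have s4 := (s1.mul_left (qpow h 2 * w)).sub (s2.mul_left (qpow h (2 - 2 * a) * w))
    have : (fun k => qTaylor h a (k + 1) * w ^ (k + 1) -
        qTaylor h a (k + 1) * (qpow h 2 * w) ^ (k + 1)) = fun k =>
        qpow h 2 * w * (qTaylor h a k * w ^ k) -
        qpow h (2 - 2 * a) * w * (qTaylor h a k * (qpow h 2 * w) ^ k) := by
      funext k
      have := qTaylor_succ hh a k
      simp only [mul_pow]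
      linear_combination (w ^ (k + 1)) * this
    rw [this] at s3
    have := s3.unique s4
    simp at this
    linear_combination this
  have hiter : ∀ w : ℂ, ‖w‖ < C⁻¹ → ∀ N : ℕ,
      p.sum w * ∏ k ∈ range N, (1 - qpow h 2 * w * qpow h (2 * k)) =
        (∏ k ∈ range N, (1 - qpow h (2 - 2 * a) * w * qpow h (2 * k))) *
          p.sum (qpow h 2 ^ N * w) := by
    intro w hw N
    induction N with
    | zero => simp
    | succ N ih =>
      have hw' : ‖qpow h 2 ^ N * w‖ < C⁻¹ := by
        have : ‖qpow h 2‖ ^ N ≤ 1 := pow_le_one₀ (norm_nonneg _) hq.le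
        rw [norm_mul, norm_pow]; nlinarith [norm_nonneg w]
      have := hfun _ hw'
      rw [prod_range_succ, prod_range_succ, ← mul_assoc, ih, qpow_mul_natCast,
        show qpow h 2 ^ (N + 1) * w = qpow h 2 * (qpow h 2 ^ N * w) by ring]
      linear_combination (∏ k ∈ range N, (1 - qpow h (2 - 2 * a) * w * qpow h (2 * k))) * this
  have hzero : p.sum 0 = 1 := by
    have := (hsum 0 (by simpa using hC)).tsum_eq
    rw [← this, tsum_eq_single 0 fun k hk => by simp [hk]]
    simp [qTaylor_zero]
  have hlim : ∀ w : ℂ, ‖w‖ < C⁻¹ →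
      p.sum w * qProd h (qpow h 2 * w) = qProd h (qpow h (2 - 2 * a) * w) := by
    intro w hw
    have t1 := ((multipliable_qProd hh (qpow h 2 * w)).hasProd.tendsto_prod_nat).const_mul (p.sum w)
    have t2 := (multipliable_qProd hh (qpow h (2 - 2 * a) * w)).hasProd.tendsto_prod_nat
    have t3 : Tendsto (fun N => p.sum (qpow h 2 ^ N * w)) atTop (nhds 1) := by
      have hc : ContinuousAt p.sum 0 := hball.continuousOn.continuousAt
        (Metric.eball_mem_nhds 0 (hr0.trans_le hr))
      rw [← hzero]
      refine hc.tendsto.comp ?_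
      simpa using (tendsto_pow_atTop_nhds_zero_of_norm_lt_one hq).mul_const w
    have t4 := t2.mul t3
    rw [mul_one] at t4
    refine tendsto_nhds_unique (t1.congr fun N => hiter w hw N) t4
  refine hball.hasFPowerSeriesAt.congr ?_
  filter_upwards [Metric.ball_mem_nhds (0 : ℂ) (inv_pos.2 hC),
    Metric.ball_mem_nhds (0 : ℂ) one_pos] with w h1 h2
  rw [mem_ball_zero_iff] at h1 h2
  rw [qRatio, eq_div_iff, hlim w h1]
  refine qProd_ne_zero_of_norm_lt_one hh ?_
  rw [norm_mul]
  nlinarith [norm_nonneg w, norm_nonneg (qpow h 2)]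

/-- The variable of the weight is `-x`, as the leading shift of `S₁` is `-a`. -/
theorem intertwinerCoeff_eq_weight {h : ℂ} (hh : h.re < 0) (a : ℂ) (k : ℕ) (x : ℂ) :
    intertwinerCoeff h a k x = weight (qbr h) (qcu h) (qgauss h) k a (-x) := by
  rw [intertwinerCoeff, taylorCoeff_of_hasFPowerSeriesAt (qRatio_hasFPowerSeriesAt hh a), weight,
    qTaylor, qcu, qgauss, qgauss, ← qpow_sub, ← qpow_add, ← qpow_add, ← mul_assoc, ← qpow_add]
  ring_nf

/-! ### The braid relations in the quantum case -/

/-- In the first variable, the multiplier `phi a` is a quotient of two values of this function. -/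
def gFirst (h x₂ y : ℂ) : ℂ := qpow h (-(y ^ 2 / 4 - y / 2)) / qProd h (qpow h (y + x₂))

/-- In the second variable, the multiplier `phi a` is a quotient of two values of this
function. -/
def gSecond (h x₁ y : ℂ) : ℂ := qpow h (y * x₁ / 2) * qProd h (qpow h (2 - x₁ - y))

/-- The multiplier in `S₂`. -/
def phi (h a : ℂ) (x : ℂ × ℂ) : ℂ := qpow h (a * x.1) *
    (qProd h (qpow h (x.2 - x.1) * qpow h (1 - a)) /
      qProd h (qpow h (x.2 - x.1) * qpow h (1 + a)))

theorem gFirst_add_two {h : ℂ} (hh : h.re < 0) (x₂ y : ℂ) (h2 : gFirst h x₂ y ≠ 0) :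
    gFirst h x₂ (y + 2) = -qpow h (1 / 2) *
      (qbr h (y / 2 - -x₂ / 2) * qcu h (y / 2 + -x₂ / 2)) * gFirst h x₂ y := by
  have e : qProd h (qpow h (y + x₂)) =
      (1 - qpow h (y + x₂)) * qProd h (qpow h (y + 2 + x₂)) := by
    rw [qProd_eq_mul hh, ← qpow_add]; ring_nf
  have e1 : qProd h (qpow h (y + x₂)) ≠ 0 := fun e0 => by simp [gFirst, e0] at h2
  have e2 := e1
  rw [e] at e2
  have k1 : qpow h (-((y + 2) ^ 2 / 4 - (y + 2) / 2)) =
      qpow h (-y) * qpow h (-(y ^ 2 / 4 - y / 2)) := by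
    rw [← qpow_add]; ring_nf
  have k2 : qpow h (1 / 2) * qpow h (-1 / 2) = 1 := by
    rw [← qpow_add, ← qpow_zero h]; ring_nf
  have k3 : qpow h (-y) * qpow h (y + x₂) = qpow h x₂ := by
    rw [← qpow_add]; ring_nf
  have k4 : 1 - qpow h (y + x₂) ≠ 0 := left_ne_zero_of_mul e2
  have k5 := right_ne_zero_of_mul e2
  rw [gFirst, gFirst, qbr_mul_qcu, e, k1, show -2 * (-x₂ / 2) = x₂ by ring,
    show -2 * (y / 2) = -y by ring]
  generalize qpow h (-(y ^ 2 / 4 - y / 2)) = E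
  generalize qpow h (-1 / 2) = F at k2 ⊢
  field_simp
  linear_combination E * ((qpow h x₂ - qpow h (-y)) * k2 - k3)

theorem phi_eq_gFirst (h a x₁ x₂ : ℂ) :
    phi h a (x₁, x₂) = gFirst h x₂ (-x₁ + 1 + a) / gFirst h x₂ (-x₁ + 1 - a) := by
  rw [phi, gFirst, gFirst, div_div_div_comm, ← qpow_sub,
    div_eq_mul_inv _ (qProd h _ / qProd h _), inv_div, ← qpow_add, ← qpow_add]
  dsimp only
  ring_nf

theorem gSecond_add_two {h : ℂ} (hh : h.re < 0) (x₁ y : ℂ) :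
    gSecond h x₁ (y + 2) = qpow h (1 / 2) *
      (qbr h (y / 2 - -x₁ / 2) * qcu h (y / 2 + -x₁ / 2)) * gSecond h x₁ y := by
  have e : qProd h (qpow h (2 - x₁ - (y + 2))) =
      (1 - qpow h (-x₁ - y)) * qProd h (qpow h (2 - x₁ - y)) := by
    rw [qProd_eq_mul hh, ← qpow_add]; ring_nf
  have k1 : qpow h ((y + 2) * x₁ / 2) = qpow h x₁ * qpow h (y * x₁ / 2) := by
    rw [← qpow_add]; ring_nf
  have k2 : qpow h (1 / 2) * qpow h (-1 / 2) = 1 := by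
    rw [← qpow_add, ← qpow_zero h]; ring_nf
  have k3 : qpow h x₁ * qpow h (-x₁ - y) = qpow h (-y) := by
    rw [← qpow_add]; ring_nf
  rw [gSecond, gSecond, qbr_mul_qcu, e, k1, show -2 * (-x₁ / 2) = x₁ by ring,
    show -2 * (y / 2) = -y by ring]
  linear_combination (-(qpow h (y * x₁ / 2) * qProd h (2 - x₁ - y |> qpow h))) *
    ((qpow h x₁ - qpow h (-y)) * k2 + k3)

theorem phi_eq_gSecond (h a x₁ x₂ : ℂ) :
    phi h a (x₁, x₂) = gSecond h x₁ (-x₂ + 1 + a) / gSecond h x₁ (-x₂ + 1 - a) := by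
  rw [phi, gSecond, gSecond, mul_div_mul_comm, ← qpow_sub, ← qpow_add, ← qpow_add]
  dsimp only
  ring_nf

theorem qProd_qpow_ne_zero {h : ℂ} (hh : h.re < 0) {α β : ℂ} (hαβ : α ≠ 0 ∨ β ≠ 0) (γ : ℂ) :
    ∀ᶠ x : ℂ × ℂ in generic (ℂ × ℂ), qProd h (qpow h (α * x.1 + β * x.2 + γ)) ≠ 0 := by
  have h0 : h ≠ 0 := by rintro rfl; simp at hh
  filter_upwards [(tendsto_generic_affine hαβ γ).eventually
    ((tendsto_generic_exp h0).eventually (qProd_ne_zero_generic hh))] with x hx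
  rwa [qpow, mul_comm]

theorem coxeterRelations {h : ℂ} (hh : h.re < 0) :
    CoxeterRelations (S₁ h) (S₂ h) (S₃ h) := by
  have hB := brackets_qbr hh
  have hW : ∀ x, qgauss h x ≠ 0 → qgauss h (x + 1) ≠ 0 →
    qgauss h (x + 1) = qcu h x * qgauss h x := fun x _ _ => qgauss_add_one h x
  have key := ShiftSeries.coxeterRelations (s := 2) (ε := -1) (c := intertwinerCoeff h)
    (φ := phi h) ?_ ?_ ?_ ?_ ?_
  · simp only [neg_one_mul] at key
    exact key
  · filter_upwards [qProd_qpow_ne_zero hh (α := -1) (β := 1) (by simp) 1] with x hx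
    rw [phi, sub_zero, add_zero, ← qpow_add, zero_mul, qpow_zero, one_mul, div_self]
    convert hx using 3; ring
  · intro a
    filter_upwards [qProd_qpow_ne_zero hh (α := -1) (β := 1) (by simp) (1 - a),
      qProd_qpow_ne_zero hh (α := -1) (β := 1) (by simp) (1 + a)] with x hx hx'
    rw [show -1 * x.1 + 1 * x.2 + (1 - a) = x.2 - x.1 + (1 - a) by ring, qpow_add] at hx
    rw [show -1 * x.1 + 1 * x.2 + (1 + a) = x.2 - x.1 + (1 + a) by ring, qpow_add] at hx'
    rw [phi, phi, sub_neg_eq_add, ← sub_eq_add_neg, neg_mul, qpow_neg]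
    have := qpow_ne_zero h (a * x.1)
    field_simp
  · intro k
    refine Eventually.of_forall fun z => ?_
    rw [intertwinerCoeff_eq_weight hh,
      hB.weight_zero hW k (qgauss_ne_zero _ _) (qgauss_ne_zero _ _)]
  · intro a b m
    have g0 := eventually_forall_le m fun k => qProd_qpow_ne_zero hh (α := -1) (β := 1)
      (by simp) (1 + 2 * a + b - 2 * k)
    have g1 := eventually_forall_le m fun k => qProd_qpow_ne_zero hh (α := -1) (β := 1)
      (by simp) (1 - b - 2 * k)
    have g2 := eventually_forall_le m fun k => qProd_qpow_ne_zero hh (α := -1) (β := 1)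
      (by simp) (1 + b - 2 * k)
    filter_upwards [g0, g1, g2] with x g0 g1 g2
    obtain ⟨x₁, x₂⟩ := x
    have key := hB.braid_sum hW (g := gFirst h x₂) (K := -qpow h (1 / 2)) (x := -x₂ / 2)
      (fun y hy _ => gFirst_add_two hh x₂ y hy) a b (-x₁) m
      (fun _ _ => qgauss_ne_zero _ _) (fun _ _ => qgauss_ne_zero _ _)
      (fun _ _ => qgauss_ne_zero _ _)
      (fun k hk => div_ne_zero (qpow_ne_zero _ _) (by convert g0 k hk using 3; ring))
      (fun k hk => div_ne_zero (qpow_ne_zero _ _) (by convert g1 k hk using 3; ring))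
      (fun k hk => div_ne_zero (qpow_ne_zero _ _) (by convert g2 k hk using 3; ring))
    simp only [intertwinerCoeff_eq_weight hh, phi_eq_gFirst]
    refine Eq.trans (sum_congr rfl fun k _ => ?_) (key.trans ?_)
    · ring_nf
    · ring_nf
  · intro a b m
    have g0 := eventually_forall_le m fun k => qProd_qpow_ne_zero hh (α := 1) (β := -1)
      (by simp) (1 - 2 * a - b + 2 * k)
    have g1 := eventually_forall_le m fun k => qProd_qpow_ne_zero hh (α := 1) (β := -1)
      (by simp) (1 + b + 2 * k)
    have g2 := eventually_forall_le m fun k => qProd_qpow_ne_zero hh (α := 1) (β := -1)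
      (by simp) (1 - b + 2 * k)
    filter_upwards [g0, g1, g2] with x g0 g1 g2
    obtain ⟨x₁, x₂⟩ := x
    have key := hB.braid_sum hW (g := gSecond h x₂) (K := qpow h (1 / 2)) (x := -x₂ / 2)
      (fun y _ _ => gSecond_add_two hh x₂ y) a b (-x₁) m
      (fun _ _ => qgauss_ne_zero _ _) (fun _ _ => qgauss_ne_zero _ _)
      (fun _ _ => qgauss_ne_zero _ _)
      (fun k hk => mul_ne_zero (qpow_ne_zero _ _) (by convert g0 k hk using 3; ring))
      (fun k hk => mul_ne_zero (qpow_ne_zero _ _) (by convert g1 k hk using 3; ring))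
      (fun k hk => mul_ne_zero (qpow_ne_zero _ _) (by convert g2 k hk using 3; ring))
    simp only [intertwinerCoeff_eq_weight hh, phi_eq_gSecond, Prod.swap]
    refine Eq.trans (sum_congr rfl fun k _ => ?_) (key.trans ?_)
    · ring_nf
    · ring_nf

end Quantum

/-! ### Addition formulas of theta functions -/

@[to_additive]
theorem hasProd_of_isCompl_range {α β γ δ : Type*} [CommMonoid α] [TopologicalSpace α]
    [ContinuousMul α] {f : δ → α} {g₁ : β → δ} {g₂ : γ → δ} {a b : α}
    (i₁ : Function.Injective g₁) (i₂ : Function.Injective g₂)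
    (hg : IsCompl (Set.range g₁) (Set.range g₂)) (h₁ : HasProd (fun x => f (g₁ x)) a)
    (h₂ : HasProd (fun x => f (g₂ x)) b) : HasProd f (a * b) :=
  HasProd.mul_isCompl hg (i₁.hasProd_range_iff.2 h₁) (i₂.hasProd_range_iff.2 h₂)

namespace Elliptic

/-- The product of two theta functions with parameter `τ`, by those with parameter `2τ`: the sum
over pairs `(n, m)` is split by the parity of `n + m`. -/
theorem jacobiTheta₂_mul {τ : ℂ} (hτ : 0 < τ.im) (u v : ℂ) :
    jacobiTheta₂ u τ * jacobiTheta₂ v τ =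
      jacobiTheta₂ (u + v) (2 * τ) * jacobiTheta₂ (u - v) (2 * τ) +
        exp (Real.pi * I * τ + 2 * Real.pi * I * u) *
          (jacobiTheta₂ (u + v + τ) (2 * τ) * jacobiTheta₂ (u - v + τ) (2 * τ)) := by
  have hτ2 : 0 < (2 * τ).im := by simpa using hτ
  have hs : ∀ {σ : ℂ}, 0 < σ.im → ∀ z w, HasSum (fun p : ℤ × ℤ =>
      jacobiTheta₂_term p.1 z σ * jacobiTheta₂_term p.2 w σ)
      (jacobiTheta₂ z σ * jacobiTheta₂ w σ) := by
    intro σ hσ z w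
    have h1 := ((summable_jacobiTheta₂_term_iff z σ).2 hσ).norm
    have h2 := ((summable_jacobiTheta₂_term_iff w σ).2 hσ).norm
    rw [jacobiTheta₂, jacobiTheta₂, tsum_mul_tsum_of_summable_norm h1 h2]
    exact (summable_mul_of_summable_norm h1 h2).hasSum
  let g₁ : ℤ × ℤ → ℤ × ℤ := fun p => (p.1 + p.2, p.1 - p.2)
  let g₂ : ℤ × ℤ → ℤ × ℤ := fun p => (p.1 + p.2 + 1, p.1 - p.2)
  have i₁ : Function.Injective g₁ := by
    rintro ⟨a, b⟩ ⟨c, d⟩ h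
    simp only [g₁, Prod.mk.injEq] at h ⊢
    omega
  have i₂ : Function.Injective g₂ := by
    rintro ⟨a, b⟩ ⟨c, d⟩ h
    simp only [g₂, Prod.mk.injEq] at h ⊢
    omega
  have hcompl : IsCompl (Set.range g₁) (Set.range g₂) := by
    constructor
    · rw [Set.disjoint_iff_forall_ne]
      rintro _ ⟨⟨a, b⟩, rfl⟩ _ ⟨⟨c, d⟩, rfl⟩ h
      simp only [g₁, g₂, Prod.mk.injEq] at h
      omega
    · rw [codisjoint_iff_le_sup]
      rintro ⟨n, m⟩ -
      rcases Int.even_or_odd' (n + m) with ⟨k, hk | hk⟩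
      · left
        refine ⟨(k, n - k), ?_⟩
        simp only [g₁, Prod.mk.injEq]
        omega
      · right
        refine ⟨(k, n - 1 - k), ?_⟩
        simp only [g₂, Prod.mk.injEq]
        omega
  refine (hs hτ u v).unique (hasSum_of_isCompl_range i₁ i₂ hcompl ?_ ?_)
  · convert hs hτ2 (u + v) (u - v) using 2 with p
    simp only [g₁, jacobiTheta₂_term, ← exp_add]
    push_cast
    ring_nf
  · refine HasSum.congr_fun ((hs hτ2 (u + v + τ) (u - v + τ)).mul_left
      (exp (Real.pi * I * τ + 2 * Real.pi * I * u))) fun p => ?_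
    simp only [g₂, jacobiTheta₂_term, ← exp_add]
    push_cast
    ring_nf

theorem theta₁_eq_jacobiTheta₂ (τ z : ℂ) :
    theta₁ τ z = exp (Real.pi * I * τ / 4 + Real.pi * I * (z + 1 / 2)) *
      jacobiTheta₂ (z + 1 / 2 + τ / 2) τ := by
  rw [theta₁, jacobiTheta₂, ← tsum_mul_left]
  refine tsum_congr fun n => ?_
  rw [jacobiTheta₂_term, ← exp_add, ← exp_add]
  ring_nf

theorem exp_neg_pi_mul_I_mul (τ z : ℂ) :
    exp (-Real.pi * I * (τ + 2 * (z + 1 / 2 - τ / 2))) = -exp (-(2 * Real.pi * I * z)) := by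
  rw [show -Real.pi * I * (τ + 2 * (z + 1 / 2 - τ / 2)) =
    -(2 * Real.pi * I * z) - Real.pi * I by ring, exp_sub, exp_pi_mul_I]
  ring

theorem theta₁_neg (τ z : ℂ) : theta₁ τ (-z) = -theta₁ τ z := by
  have h : jacobiTheta₂ (z + 1 / 2 + τ / 2) τ =
      -exp (-(2 * Real.pi * I * z)) * jacobiTheta₂ (-z + 1 / 2 + τ / 2) τ := by
    rw [← jacobiTheta₂_neg_left (-z + 1 / 2 + τ / 2), ← jacobiTheta₂_add_left (-_),
      show z + 1 / 2 + τ / 2 = z + 1 / 2 - τ / 2 + τ by ring, jacobiTheta₂_add_left',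
      exp_neg_pi_mul_I_mul]
    ring_nf
  rw [theta₁_eq_jacobiTheta₂, theta₁_eq_jacobiTheta₂, h,
    show Real.pi * I * τ / 4 + Real.pi * I * (-z + 1 / 2) =
      Real.pi * I * τ / 4 + Real.pi * I * (z + 1 / 2) + -(2 * Real.pi * I * z) by ring, exp_add]
  ring

/-- The even theta function `θ₃(2x | 2τ)`. -/
def thetaA (τ x : ℂ) : ℂ := jacobiTheta₂ (2 * x) (2 * τ)

/-- The even theta function `θ₂(2x | 2τ)`. -/
def thetaB (τ x : ℂ) : ℂ :=
  exp (Real.pi * I * τ / 2 + 2 * Real.pi * I * x) * jacobiTheta₂ (2 * x + τ) (2 * τ)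

/-- The product on the left is a `2 × 2` determinant, so that the addition formulas for `θ₁` are
identities between determinants. -/
theorem theta₁_add_mul_theta₁_sub {τ : ℂ} (hτ : 0 < τ.im) (x y : ℂ) :
    theta₁ τ (x + y) * theta₁ τ (x - y) =
      thetaA τ x * thetaB τ y - thetaB τ x * thetaA τ y := by
  have h1 : jacobiTheta₂ (2 * x + 1 + 2 * τ) (2 * τ) =
      exp (-(4 * Real.pi * I * x) - 2 * Real.pi * I * τ) * jacobiTheta₂ (2 * x) (2 * τ) := by
    rw [jacobiTheta₂_add_left', jacobiTheta₂_add_left]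
    congr 1
    rw [show -Real.pi * I * (2 * τ + 2 * (2 * x + 1)) =
      -(4 * Real.pi * I * x) - 2 * Real.pi * I * τ - 2 * Real.pi * I by ring, exp_sub _ (2 * _ * _),
      exp_two_pi_mul_I, div_one]
  rw [theta₁_eq_jacobiTheta₂, theta₁_eq_jacobiTheta₂, mul_mul_mul_comm, jacobiTheta₂_mul hτ,
    show x + y + 1 / 2 + τ / 2 + (x - y + 1 / 2 + τ / 2) = 2 * x + τ + 1 by ring,
    show x + y + 1 / 2 + τ / 2 - (x - y + 1 / 2 + τ / 2) = 2 * y by ring,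
    jacobiTheta₂_add_left, show 2 * x + τ + 1 + τ = 2 * x + 1 + 2 * τ by ring, h1,
    thetaA, thetaB, thetaA, thetaB]
  have e1 : exp (Real.pi * I * τ / 4 + Real.pi * I * (x + y + 1 / 2)) *
      exp (Real.pi * I * τ / 4 + Real.pi * I * (x - y + 1 / 2)) =
      -exp (Real.pi * I * τ / 2 + 2 * Real.pi * I * x) := by
    rw [← mul_neg_one, ← exp_pi_mul_I, ← exp_add, ← exp_add]
    ring_nf
  have e2 : -exp (Real.pi * I * τ / 2 + 2 * Real.pi * I * x) *
      (exp (Real.pi * I * τ + 2 * Real.pi * I * (x + y + 1 / 2 + τ / 2)) *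
      exp (-(4 * Real.pi * I * x) - 2 * Real.pi * I * τ)) =
      exp (Real.pi * I * τ / 2 + 2 * Real.pi * I * y) := by
    rw [← mul_neg_one, ← exp_neg_pi_mul_I, ← exp_add, ← exp_add, ← exp_add]
    ring_nf
  rw [e1]
  linear_combination (jacobiTheta₂ (2 * x) (2 * τ) * jacobiTheta₂ (2 * y + τ) (2 * τ)) * e2

theorem brackets_ellNum {τ : ℂ} (η L : ℂ) (hτ : 0 < τ.im)
    (hk : ∀ k : ℕ, 1 ≤ k → ellNum τ η (k : ℂ) ≠ 0) :
    Brackets (ellNum τ η) (fun x => L * ellNum τ η x) where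
  neg x := by rw [ellNum, mul_neg, theta₁_neg]; rfl
  nat_ne_zero k := by exact_mod_cast hk (k + 1) (by omega)
  plucker x y u v := by
    have h : ∀ a b, ellNum τ η (a - b) * (L * ellNum τ η (a + b)) =
        L * (thetaA τ (2 * η * a) * thetaB τ (2 * η * b) -
          thetaB τ (2 * η * a) * thetaA τ (2 * η * b)) := by
      intro a b
      rw [← theta₁_add_mul_theta₁_sub hτ, ellNum, ellNum]
      ring_nf
    simp only [h]
    ring
  pascal N M P k := by
    have h : ∀ a b, ellNum τ η (a + b) * ellNum τ η (a - b) =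
        thetaA τ (2 * η * a) * thetaB τ (2 * η * b) -
          thetaB τ (2 * η * a) * thetaA τ (2 * η * b) := by
      intro a b
      rw [← theta₁_add_mul_theta₁_sub hτ, ellNum, ellNum]
      ring_nf
    -- the four points whose sums and differences are the arguments that occur
    set s := (P - M) / 2 + N - k with hs
    set t := (P - M) / 2 - k with ht
    set w := (M + P) / 2 with hw
    set d := (P - M) / 2 with hd
    have h1 := h s t
    have h2 := h w d
    have h3 := h s d
    have h4 := h w t
    have h5 := h d t
    have h6 := h w s
    rw [show s + t = P - M + N - 2 * k by rw [hs, ht]; ring,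
      show s - t = N by rw [hs, ht]; ring] at h1
    rw [show w + d = P by rw [hw, hd]; ring, show w - d = M by rw [hw, hd]; ring] at h2
    rw [show s + d = P - M + N - k by rw [hs, hd]; ring,
      show s - d = N - k by rw [hs, hd]; ring] at h3
    rw [show w + t = P - k by rw [hw, ht]; ring, show w - t = M + k by rw [hw, ht]; ring] at h4
    rw [show d + t = P - M - k by rw [hd, ht]; ring, show d - t = k by rw [hd, ht]; ring] at h5
    rw [show w + s = P + N - k by rw [hw, hs]; ring,
      show w - s = M + k - N by rw [hw, hs]; ring] at h6
    calc _ = L ^ 2 * ((ellNum τ η (P - M + N - 2 * k) * ellNum τ η N) *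
          (ellNum τ η P * ellNum τ η M)) := by ring
      _ = L ^ 2 * ((ellNum τ η (P - M + N - k) * ellNum τ η (N - k)) *
          (ellNum τ η (P - k) * ellNum τ η (M + k)) +
          (ellNum τ η (P - M - k) * ellNum τ η k) *
          (ellNum τ η (P + N - k) * ellNum τ η (M + k - N))) := by
        rw [h1, h2, h3, h4, h5, h6]; ring
      _ = _ := by ring

end Elliptic

namespace Elliptic

/-! ### Jacobi's triple product -/

/-- The `q`-shifted factorial `(q; q)_n = (1 - q) ⋯ (1 - q^n)`. -/
def qFac (q : ℂ) (n : ℕ) : ℂ := ∏ l ∈ range n, (1 - q ^ (l + 1))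

theorem qFac_succ (q : ℂ) (n : ℕ) : qFac q (n + 1) = qFac q n * (1 - q ^ (n + 1)) :=
  prod_range_succ _ _

theorem one_sub_pow_ne_zero {q : ℂ} (hq : ‖q‖ < 1) (n : ℕ) : 1 - q ^ (n + 1) ≠ 0 := by
  intro h
  have h1 := pow_lt_one₀ (norm_nonneg _) hq n.succ_ne_zero
  rw [← norm_pow, ← sub_eq_zero.1 h, norm_one] at h1
  exact lt_irrefl _ h1

theorem qFac_ne_zero {q : ℂ} (hq : ‖q‖ < 1) (n : ℕ) : qFac q n ≠ 0 :=
  prod_ne_zero_iff.2 fun l _ => one_sub_pow_ne_zero hq l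

/-- Gauss's `q`-binomial formula; `T` is the sequence `(-1)^i q^(i (i - 1) / 2)`, given by its
recursion. -/
theorem prod_one_sub_pow_mul {q : ℂ} (hq : ‖q‖ < 1) {T : ℕ → ℂ} (h0 : T 0 = 1)
    (hT : ∀ i, T (i + 1) = -(q ^ i * T i)) (y : ℂ) (n : ℕ) :
    ∏ l ∈ range n, (1 - q ^ l * y) = ∑ k ∈ antidiagonal n,
      qFac q n / (qFac q k.1 * qFac q k.2) * (T k.1 * y ^ k.1) := by
  have key := prod_eq_sum_antidiagonal_of_pascal (fun l => 1 - q ^ l * y) (fun _ => y)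
    (fun _ => 1) (fun i j => -q ^ (i + j)) (fun _ _ => 1)
    (fun i j => T i * qFac q (i + j) / (qFac q i * qFac q j)) n
    (fun i j _ => by ring) ?_ ?_ ?_ ?_
  · rw [key]
    refine sum_congr rfl fun k hk => ?_
    rw [HasAntidiagonal.mem_antidiagonal] at hk
    rw [hk, prod_const, prod_const, card_range, one_pow]
    ring
  · simp [h0, qFac]
  · intro i _
    have := qFac_ne_zero hq i
    have := qFac_ne_zero hq (i + 1)
    have := qFac_ne_zero hq 0
    simp only [hT, add_zero]
    field_simp
  · intro j _
    have := qFac_ne_zero hq j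
    have := qFac_ne_zero hq (j + 1)
    have := qFac_ne_zero hq 0
    simp only [zero_add]
    field_simp
  · intro i j _
    have e1 := qFac_ne_zero hq i
    have e2 := qFac_ne_zero hq j
    have e3 := one_sub_pow_ne_zero hq i
    have e4 := one_sub_pow_ne_zero hq j
    rw [show i + 1 + (j + 1) = i + (j + 1) + 1 by ring, show i + 1 + j = i + (j + 1) by ring,
      hT, qFac_succ _ (i + (j + 1)), qFac_succ _ i, qFac_succ _ j]
    field_simp
    ring

theorem norm_exp_two_pi_lt_one {τ : ℂ} (hτ : 0 < τ.im) : ‖exp (2 * Real.pi * I * τ)‖ < 1 := by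
  rw [norm_exp, Real.exp_lt_one_iff]
  simp
  positivity

/-- The finite form of Jacobi's triple product: the `q`-binomial formula with `2n` factors, indexed
from its middle term. The sum is written over `ℤ` for passing to the limit termwise. -/
theorem finite_triple_product {τ : ℂ} (hτ : 0 < τ.im) (z : ℂ) (n : ℕ) :
    (∏ l ∈ range n, (1 - exp (2 * Real.pi * I * (τ * (l + 1) - z)))) *
      ∏ l ∈ range n, (1 - exp (2 * Real.pi * I * (τ * l + z))) =
    ∑' k : ℤ, if k ∈ Icc (-n : ℤ) n then
      qFac (exp (2 * Real.pi * I * τ)) (2 * n) /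
        (qFac (exp (2 * Real.pi * I * τ)) (n + k).toNat *
          qFac (exp (2 * Real.pi * I * τ)) (n - k).toNat) *
        jacobiTheta₂_term k (z + 1 / 2 - τ / 2) τ else 0 := by
  set q := exp (2 * Real.pi * I * τ) with hq
  have hq1 : ‖q‖ < 1 := norm_exp_two_pi_lt_one hτ
  let T : ℕ → ℂ := fun i => exp (Real.pi * I * τ * (i * (i - 1)) + Real.pi * I * i)
  have hT : ∀ i, T (i + 1) = -(q ^ i * T i) := by
    intro i
    rw [← neg_one_mul, ← exp_pi_mul_I, hq, ← exp_nat_mul, ← exp_add, ← exp_add]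
    simp only [T]
    push_cast
    ring_nf
  -- the ratio between the two sides of the `q`-binomial formula and of the claim
  set c := exp (Real.pi * I * n - Real.pi * I * τ * (n * (n + 1)) + 2 * Real.pi * I * n * z) with hc
  have key := prod_one_sub_pow_mul hq1 (T := T) (by simp [T]) hT
    (exp (2 * Real.pi * I * (z - n * τ))) (n + n)
  have hL : ∏ l ∈ range (n + n), (1 - q ^ l * exp (2 * Real.pi * I * (z - n * τ))) =
      c * ((∏ l ∈ range n, (1 - exp (2 * Real.pi * I * (τ * (l + 1) - z)))) *
      ∏ l ∈ range n, (1 - exp (2 * Real.pi * I * (τ * l + z)))) := by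
    rw [prod_range_add, ← mul_assoc]
    congr 1
    · have hc' : c = ∏ l ∈ range n, (-exp (2 * Real.pi * I * (z - τ * (l + 1)))) := by
        rw [hc]
        clear key hc
        clear_value q
        induction n with
        | zero => simp
        | succ n ih =>
          rw [prod_range_succ, ← ih, ← neg_one_mul, ← exp_pi_mul_I, ← exp_add, ← exp_add]
          push_cast
          ring_nf
      rw [hc', ← prod_mul_distrib, ← prod_range_reflect]
      refine prod_congr rfl fun l hl => ?_
      rw [mem_range] at hl
      rw [Nat.sub_sub, hq, ← exp_nat_mul, ← exp_add, Nat.cast_sub (by omega)]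
      have h1 : exp (2 * Real.pi * I * (z - τ * (l + 1))) *
          exp (2 * Real.pi * I * (τ * (l + 1) - z)) = 1 := by
        rw [← exp_add, ← exp_zero]
        ring_nf
      have h2 : exp ((n - (1 + l : ℕ) : ℂ) * (2 * Real.pi * I * τ) +
          2 * Real.pi * I * (z - n * τ)) = exp (2 * Real.pi * I * (z - τ * (l + 1))) := by
        push_cast
        ring_nf
      linear_combination -h1 - h2
    · refine prod_congr rfl fun l hl => ?_
      rw [hq, ← exp_nat_mul, ← exp_add]
      push_cast
      ring_nf
  rw [hL] at key
  refine mul_left_cancel₀ (exp_ne_zero _ : c ≠ 0) (key.trans ?_)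
  rw [tsum_eq_sum (s := Icc (-n : ℤ) n) fun k hk => if_neg hk, mul_sum]
  refine sum_nbij' (fun p => (p.1 : ℤ) - n) (fun k => ((n + k).toNat, (n - k).toNat)) ?_ ?_ ?_ ?_ ?_
  · rintro ⟨i, j⟩ h
    rw [HasAntidiagonal.mem_antidiagonal] at h
    simp only [mem_Icc] at h ⊢
    omega
  · intro k h
    rw [HasAntidiagonal.mem_antidiagonal]
    simp only [mem_Icc] at h ⊢
    omega
  · rintro ⟨i, j⟩ h
    rw [HasAntidiagonal.mem_antidiagonal] at h
    simp only [Prod.mk.injEq] at h ⊢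
    omega
  · intro k h
    simp only [mem_Icc] at h ⊢
    omega
  · rintro ⟨i, j⟩ h
    rw [HasAntidiagonal.mem_antidiagonal] at h
    simp only at h ⊢
    rw [if_pos (by rw [mem_Icc]; omega), show ((n : ℤ) + (i - n)).toNat = i by omega,
      show ((n : ℤ) - (i - n)).toNat = j by omega, show 2 * n = n + n from two_mul n]
    have : T i * exp (2 * Real.pi * I * (z - n * τ)) ^ i =
        c * jacobiTheta₂_term (i - n) (z + 1 / 2 - τ / 2) τ := by
      rw [hc, jacobiTheta₂_term, ← exp_nat_mul, ← exp_add, ← exp_add]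
      push_cast
      ring_nf
    rw [this]
    ring

theorem summable_exp_mul {τ : ℂ} (hτ : 0 < τ.im) :
    Summable fun n : ℕ => exp (2 * Real.pi * I * (τ * n)) := by
  have : ∀ n : ℕ, exp (2 * Real.pi * I * (τ * n)) = exp (2 * Real.pi * I * τ) ^ n := by
    intro n; rw [← exp_nat_mul]; ring_nf
  simp only [this]
  exact summable_geometric_of_norm_lt_one (norm_exp_two_pi_lt_one hτ)

end Elliptic

namespace Elliptic

/-- The infinite product `(q; q)_∞`, where `q = exp (2πiτ)`. -/
def qFacInf (τ : ℂ) : ℂ := ∏' l : ℕ, (1 - exp (2 * Real.pi * I * τ) ^ (l + 1))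

theorem qFacInf_ne_zero {τ : ℂ} (hτ : 0 < τ.im) : qFacInf τ ≠ 0 := by
  have hq := norm_exp_two_pi_lt_one hτ
  have hs : Summable fun l : ℕ => exp (2 * Real.pi * I * τ) ^ (l + 1) :=
    (summable_nat_add_iff 1).2 (summable_geometric_of_norm_lt_one hq)
  have := tprod_one_add_ne_zero_of_summable
    (f := fun l : ℕ => -exp (2 * Real.pi * I * τ) ^ (l + 1))
    (fun l => by simpa [sub_eq_add_neg] using one_sub_pow_ne_zero hq l) hs.norm.of_norm.neg.norm
  simpa [qFacInf, sub_eq_add_neg] using this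

theorem tendsto_qFac {τ : ℂ} (hτ : 0 < τ.im) :
    Tendsto (qFac (exp (2 * Real.pi * I * τ))) atTop (nhds (qFacInf τ)) := by
  have hq := norm_exp_two_pi_lt_one hτ
  have hs : Summable fun l : ℕ => exp (2 * Real.pi * I * τ) ^ (l + 1) :=
    (summable_nat_add_iff 1).2 (summable_geometric_of_norm_lt_one hq)
  have := multipliable_one_sub hs 1
  simp only [mul_one] at this
  exact this.hasProd.tendsto_prod_nat

/-- The product `∏_{l ≥ 0} (1 - exp (2πi(τ(l + 1) - z)))`. -/
def thetaNum (τ z : ℂ) : ℂ := ∏' l : ℕ, (1 - exp (2 * Real.pi * I * (τ * (l + 1) - z)))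

/-- The product `∏_{l ≥ 0} (1 - exp (2πi(τ l + z)))`. -/
def thetaDen (τ z : ℂ) : ℂ := ∏' l : ℕ, (1 - exp (2 * Real.pi * I * (τ * l + z)))

theorem multipliable_thetaNum {τ : ℂ} (hτ : 0 < τ.im) (z : ℂ) :
    Multipliable fun l : ℕ => 1 - exp (2 * Real.pi * I * (τ * (l + 1) - z)) := by
  convert multipliable_one_sub (summable_exp_mul hτ) (exp (2 * Real.pi * I * (τ - z))) using 3
  rw [← exp_add]
  ring_nf

theorem multipliable_thetaDen {τ : ℂ} (hτ : 0 < τ.im) (z : ℂ) :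
    Multipliable fun l : ℕ => 1 - exp (2 * Real.pi * I * (τ * l + z)) := by
  convert multipliable_one_sub (summable_exp_mul hτ) (exp (2 * Real.pi * I * z)) using 3
  rw [← exp_add]
  ring_nf

/-- Jacobi's triple product, as the limit of `finite_triple_product`. -/
theorem jacobiTheta₂_eq_prod {τ : ℂ} (hτ : 0 < τ.im) (z : ℂ) :
    jacobiTheta₂ (z + 1 / 2 - τ / 2) τ = qFacInf τ * (thetaNum τ z * thetaDen τ z) := by
  have hQ := qFacInf_ne_zero hτ
  have hF := tendsto_qFac hτ
  have hL := ((multipliable_thetaNum hτ z).hasProd.tendsto_prod_nat).mul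
    (multipliable_thetaDen hτ z).hasProd.tendsto_prod_nat
  simp only [finite_triple_product hτ z] at hL
  set F := qFac (exp (2 * Real.pi * I * τ)) with hFdef
  obtain ⟨M, hM⟩ := hF.norm.bddAbove_range
  obtain ⟨M', hM'⟩ := (hF.inv₀ hQ).norm.bddAbove_range
  have hM : ∀ n, ‖F n‖ ≤ M := fun n => hM ⟨n, rfl⟩
  have hM' : ∀ n, ‖(F n)⁻¹‖ ≤ M' := fun n => hM' ⟨n, rfl⟩
  have hM0 : 0 ≤ M := (norm_nonneg _).trans (hM 0)
  have hM0' : 0 ≤ M' := (norm_nonneg _).trans (hM' 0)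
  have hR := tendsto_tsum_of_dominated_convergence (𝓕 := atTop)
    (f := fun (n : ℕ) (k : ℤ) => if k ∈ Icc (-n : ℤ) n then
      F (2 * n) / (F (n + k).toNat * F (n - k).toNat) *
        jacobiTheta₂_term k (z + 1 / 2 - τ / 2) τ else 0)
    (g := fun k : ℤ => qFacInf τ / (qFacInf τ * qFacInf τ) *
        jacobiTheta₂_term k (z + 1 / 2 - τ / 2) τ)
    (bound := fun k : ℤ => M * (M' * M') * ‖jacobiTheta₂_term k (z + 1 / 2 - τ / 2) τ‖)
    (((summable_jacobiTheta₂_term_iff _ τ).2 hτ).norm.mul_left _) ?_ ?_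
  · have := tendsto_nhds_unique hL hR
    rw [thetaNum, thetaDen, this, tsum_mul_left, jacobiTheta₂]
    field_simp
  · intro k
    have ht : Tendsto (fun n : ℕ => F (2 * n) / (F (n + k).toNat * F (n - k).toNat) *
        jacobiTheta₂_term k (z + 1 / 2 - τ / 2) τ) atTop
        (nhds (qFacInf τ / (qFacInf τ * qFacInf τ) *
          jacobiTheta₂_term k (z + 1 / 2 - τ / 2) τ)) := by
      refine Tendsto.mul_const _ (Tendsto.div (hF.comp ?_)
        (Tendsto.mul (hF.comp ?_) (hF.comp ?_)) (mul_ne_zero hQ hQ))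
      · exact tendsto_atTop_mono (fun n => show n ≤ 2 * n by omega) tendsto_id
      · refine tendsto_atTop.2 fun b => ?_
        filter_upwards [eventually_ge_atTop (b + k.natAbs)] with n hn
        omega
      · refine tendsto_atTop.2 fun b => ?_
        filter_upwards [eventually_ge_atTop (b + k.natAbs)] with n hn
        omega
    refine ht.congr' ?_
    filter_upwards [eventually_ge_atTop k.natAbs] with n hn
    rw [if_pos (by rw [mem_Icc]; omega)]
  · refine Eventually.of_forall fun n k => ?_
    split_ifs
    · rw [norm_mul, div_eq_mul_inv, mul_inv, norm_mul, norm_mul]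
      gcongr
      exacts [hM _, hM' _, hM' _]
    · rw [norm_zero]
      positivity

/-- The constant in the product formula for `θ₁`. -/
def thetaConst (τ : ℂ) : ℂ := -exp (Real.pi * I * τ / 4 + Real.pi * I / 2) * qFacInf τ

theorem thetaConst_ne_zero {τ : ℂ} (hτ : 0 < τ.im) : thetaConst τ ≠ 0 :=
  mul_ne_zero (neg_ne_zero.2 (exp_ne_zero _)) (qFacInf_ne_zero hτ)

/-- The product formula for `θ₁`. -/
theorem theta₁_eq_prod {τ : ℂ} (hτ : 0 < τ.im) (z : ℂ) :
    theta₁ τ z = thetaConst τ * exp (-Real.pi * I * z) * (thetaNum τ z * thetaDen τ z) := by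
  rw [theta₁_eq_jacobiTheta₂, show z + 1 / 2 + τ / 2 = z + 1 / 2 - τ / 2 + τ by ring,
    jacobiTheta₂_add_left', exp_neg_pi_mul_I_mul, jacobiTheta₂_eq_prod hτ, thetaConst]
  have : exp (Real.pi * I * τ / 4 + Real.pi * I * (z + 1 / 2)) * exp (-(2 * Real.pi * I * z)) =
      exp (Real.pi * I * τ / 4 + Real.pi * I / 2) * exp (-Real.pi * I * z) := by
    rw [← exp_add, ← exp_add]
    ring_nf
  linear_combination (-(qFacInf τ * (thetaNum τ z * thetaDen τ z))) * this

/-! ### The elliptic gamma function -/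

theorem summable_exp_mul_add_mul {τ τ' : ℂ} (hτ : 0 < τ.im) (hτ' : 0 < τ'.im) :
    Summable fun p : ℕ × ℕ => exp (2 * Real.pi * I * (τ * p.1 + τ' * p.2)) := by
  have := summable_mul_of_summable_norm (summable_exp_mul hτ).norm (summable_exp_mul hτ').norm
  refine this.congr fun p => ?_
  rw [← exp_add]
  ring_nf

/-- The numerator of the elliptic gamma function. -/
def gammaNum (τ τ' z : ℂ) : ℂ := ∏' p : ℕ × ℕ,
  (1 - exp (2 * Real.pi * I * (τ * ((p.1 : ℂ) + 1) + τ' * ((p.2 : ℂ) + 1) - z)))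

/-- The denominator of the elliptic gamma function. -/
def gammaDen (τ τ' z : ℂ) : ℂ := ∏' p : ℕ × ℕ,
  (1 - exp (2 * Real.pi * I * (τ * (p.1 : ℂ) + τ' * (p.2 : ℂ) + z)))

theorem multipliable_gammaNum {τ τ' : ℂ} (hτ : 0 < τ.im) (hτ' : 0 < τ'.im) (z : ℂ) :
    Multipliable fun p : ℕ × ℕ =>
      1 - exp (2 * Real.pi * I * (τ * ((p.1 : ℂ) + 1) + τ' * ((p.2 : ℂ) + 1) - z)) := by
  convert multipliable_one_sub (summable_exp_mul_add_mul hτ hτ')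
    (exp (2 * Real.pi * I * (τ + τ' - z))) using 3
  rw [← exp_add]
  ring_nf

theorem multipliable_gammaDen {τ τ' : ℂ} (hτ : 0 < τ.im) (hτ' : 0 < τ'.im) (z : ℂ) :
    Multipliable fun p : ℕ × ℕ =>
      1 - exp (2 * Real.pi * I * (τ * (p.1 : ℂ) + τ' * (p.2 : ℂ) + z)) := by
  convert multipliable_one_sub (summable_exp_mul_add_mul hτ hτ')
    (exp (2 * Real.pi * I * z)) using 3
  rw [← exp_add]
  ring_nf

theorem isCompl_range_row :
    IsCompl (Set.range fun n : ℕ => (n, 0)) (Set.range fun p : ℕ × ℕ => (p.1, p.2 + 1)) := by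
  constructor
  · rw [Set.disjoint_iff_forall_ne]
    rintro _ ⟨a, rfl⟩ _ ⟨⟨c, d⟩, rfl⟩ h
    simp at h
  · rw [codisjoint_iff_le_sup]
    rintro ⟨n, m⟩ -
    cases m with
    | zero => exact Or.inl ⟨n, rfl⟩
    | succ m => exact Or.inr ⟨(n, m), rfl⟩

theorem tprod_prod_eq_tprod_row_mul {f : ℕ × ℕ → ℂ} (h : Multipliable fun n => f (n, 0))
    (h' : Multipliable fun p : ℕ × ℕ => f (p.1, p.2 + 1)) :
    ∏' p, f p = (∏' n, f (n, 0)) * ∏' p : ℕ × ℕ, f (p.1, p.2 + 1) := by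
  refine (hasProd_of_isCompl_range (fun a b hab => ?_) (fun a b hab => ?_) isCompl_range_row
    h.hasProd h'.hasProd).tprod_eq
  · simpa using hab
  · simpa [Prod.ext_iff] using hab

theorem gammaDen_eq {τ τ' : ℂ} (hτ : 0 < τ.im) (hτ' : 0 < τ'.im) (z : ℂ) :
    gammaDen τ τ' z = thetaDen τ z * gammaDen τ τ' (z + τ') := by
  have e : ∀ p : ℕ × ℕ, 1 - exp (2 * Real.pi * I * (τ * p.1 + τ' * (p.2 + 1 : ℕ) + z)) =
      1 - exp (2 * Real.pi * I * (τ * p.1 + τ' * p.2 + (z + τ'))) := by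
    intro p; push_cast; ring_nf
  have h := multipliable_thetaDen hτ z
  have h' := multipliable_gammaDen hτ hτ' (z + τ')
  rw [gammaDen, tprod_prod_eq_tprod_row_mul]
  · simp only [e]
    simp [thetaDen, gammaDen]
  · simpa using h
  · simpa only [e] using h'

theorem gammaNum_add {τ τ' : ℂ} (hτ : 0 < τ.im) (hτ' : 0 < τ'.im) (z : ℂ) :
    gammaNum τ τ' (z + τ') = thetaNum τ z * gammaNum τ τ' z := by
  have e0 : ∀ n : ℕ, 1 - exp (2 * Real.pi * I *
      (τ * (n + 1) + τ' * ((0 : ℕ) + 1) - (z + τ'))) =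
      1 - exp (2 * Real.pi * I * (τ * (n + 1) - z)) := by
    intro n; push_cast; ring_nf
  have e : ∀ p : ℕ × ℕ, 1 - exp (2 * Real.pi * I *
      (τ * (p.1 + 1) + τ' * ((p.2 + 1 : ℕ) + 1) - (z + τ'))) =
      1 - exp (2 * Real.pi * I * (τ * (p.1 + 1) + τ' * (p.2 + 1) - z)) := by
    intro p; push_cast; ring_nf
  have h := multipliable_thetaNum hτ z
  have h' := multipliable_gammaNum hτ hτ' z
  rw [gammaNum, tprod_prod_eq_tprod_row_mul]
  · simp only [e, e0]
    rfl
  · simpa only [e0] using h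
  · simpa only [e] using h'

/-- The functional equation of `γ`: `γ(x + 2) / γ(x)` is `θ₁(ηx | τ)` up to an exponential. At a
pole of `γ` the formula takes the value `0`, hence `hx`. -/
theorem gam_add_two {τ η : ℂ} (hτ : 0 < τ.im) (hη : 0 < η.im) {x : ℂ} (hx : gam τ η x ≠ 0) :
    gam τ η (x + 2) =
      (thetaConst τ)⁻¹ * exp (Real.pi * I * η * x) * ellNum τ η (x / 2) * gam τ η x := by
  have hη2 : 0 < (2 * η).im := by simpa using hη
  have hg : ∀ y, gam τ η y = gammaNum τ (2 * η) (η * y) / gammaDen τ (2 * η) (η * y) :=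
    fun _ => rfl
  have hD : gammaDen τ (2 * η) (η * x) ≠ 0 := fun h => hx (by rw [hg, h, div_zero])
  have hC := thetaConst_ne_zero hτ
  rw [gammaDen_eq hτ hη2] at hD
  have h1 := left_ne_zero_of_mul hD
  have h2 := right_ne_zero_of_mul hD
  have he : exp (Real.pi * I * η * x) * exp (-Real.pi * I * (η * x)) = 1 := by
    rw [← exp_add, ← exp_zero]
    ring_nf
  rw [hg, hg x, show η * (x + 2) = η * x + 2 * η by ring, gammaNum_add hτ hη2,
    gammaDen_eq hτ hη2 (η * x), ellNum, show 2 * η * (x / 2) = η * x by ring, theta₁_eq_prod hτ]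
  generalize exp (Real.pi * I * η * x) = E at he ⊢
  generalize exp (-Real.pi * I * (η * x)) = E' at he ⊢
  generalize gammaDen τ (2 * η) (η * x + 2 * η) = G at h2 ⊢
  generalize gammaNum τ (2 * η) (η * x) = N
  field_simp
  linear_combination (-(thetaNum τ (η * x) * N)) * he

theorem gam_ne_zero_generic {τ η : ℂ} (hτ : 0 < τ.im) (hη : 0 < η.im) :
    ∀ᶠ x in generic ℂ, gam τ η x ≠ 0 := by
  have hη2 : 0 < (2 * η).im := by simpa using hη
  have hη0 : η ≠ 0 := by rintro rfl; simp at hη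
  have hs := summable_exp_mul_add_mul hτ hη2
  have hc : 2 * Real.pi * I * η ≠ 0 := mul_ne_zero two_pi_I_ne_zero hη0
  filter_upwards [(tendsto_generic_exp (neg_ne_zero.2 hc)).eventually
      (tprod_one_sub_ne_zero_generic (hs.mul_right (exp (2 * Real.pi * I * (τ + 2 * η))))
        fun _ => mul_ne_zero (exp_ne_zero _) (exp_ne_zero _)),
    (tendsto_generic_exp hc).eventually
      (tprod_one_sub_ne_zero_generic hs fun _ => exp_ne_zero _)] with x h1 h2
  refine div_ne_zero ?_ ?_
  · convert h1 using 4
    rw [← exp_add, ← exp_add]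
    ring_nf
  · convert h2 using 4
    rw [← exp_add]
    ring_nf

end Elliptic

namespace Elliptic

variable {τ η : ℂ}

/-! ### Elliptic deformation -/

/-- The constant in the functional equation of `gaussGam`. -/
def gaussConst (τ η : ℂ) : ℂ := (thetaConst τ)⁻¹ * exp (-Real.pi * I * η)

theorem gaussConst_ne_zero (hτ : 0 < τ.im) : gaussConst τ η ≠ 0 :=
  mul_ne_zero (inv_ne_zero (thetaConst_ne_zero hτ)) (exp_ne_zero _)

/-- The function `W(z) = γ(2z) exp (-πiηz²)`; then `W(z + 1) = L [z] W(z)` with the constant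
`L = gaussConst`, and `{z} = L [z]` is the companion of the bracket `[z]`. -/
def gaussGam (τ η z : ℂ) : ℂ := gam τ η (2 * z) * exp (-Real.pi * I * η * z ^ 2)

/-- The multiplier in `S₂`. -/
def phi (τ η a : ℂ) (z : ℂ × ℂ) : ℂ := exp (-2 * Real.pi * I * a * η * z.1) *
    (gam τ η (z.1 + z.2 + 1 + a) / gam τ η (z.1 + z.2 + 1 - a)) *
    (gam τ η (z.1 - z.2 + 1 + a) / gam τ η (z.1 - z.2 + 1 - a))

/-- In the first variable, the multiplier `phi a` is a quotient of two values of this function. -/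
def gFirst (τ η x₂ y : ℂ) : ℂ :=
  exp (-Real.pi * I * η * (y ^ 2 / 2 - y)) * gam τ η (y + x₂) * gam τ η (y - x₂)

/-- In the second variable, the multiplier `phi a` is a quotient of two values of this
function. -/
def gSecond (τ η x₁ y : ℂ) : ℂ :=
  exp (-Real.pi * I * η * (x₁ * y)) * gam τ η (x₁ + y) / gam τ η (x₁ + 2 - y)

theorem gaussGam_add_one (hτ : 0 < τ.im) (hη : 0 < η.im) {z : ℂ} (hz : gaussGam τ η z ≠ 0) :
    gaussGam τ η (z + 1) = gaussConst τ η * ellNum τ η z * gaussGam τ η z := by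
  have e : exp (Real.pi * I * η * (2 * z)) * exp (-Real.pi * I * η * (z + 1) ^ 2) =
      exp (-Real.pi * I * η) * exp (-Real.pi * I * η * z ^ 2) := by
    rw [← exp_add, ← exp_add]
    ring_nf
  rw [gaussGam, mul_add, mul_one, gam_add_two hτ hη (left_ne_zero_of_mul hz), gaussConst, gaussGam,
    mul_div_cancel_left₀ z two_ne_zero]
  linear_combination ((thetaConst τ)⁻¹ * ellNum τ η z * gam τ η (2 * z)) * e

theorem phi_eq_gFirst (a x₁ x₂ : ℂ) :
    phi τ η a (x₁, x₂) = gFirst τ η x₂ (x₁ + 1 + a) / gFirst τ η x₂ (x₁ + 1 - a) := by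
  have e : exp (-2 * Real.pi * I * a * η * x₁) =
      exp (-Real.pi * I * η * ((x₁ + 1 + a) ^ 2 / 2 - (x₁ + 1 + a))) /
        exp (-Real.pi * I * η * ((x₁ + 1 - a) ^ 2 / 2 - (x₁ + 1 - a))) := by
    rw [← exp_sub]
    ring_nf
  rw [phi, e, gFirst, gFirst, mul_div_mul_comm, mul_div_mul_comm]
  dsimp only
  ring_nf

theorem phi_eq_gSecond (a x₁ x₂ : ℂ) :
    phi τ η a (x₁, x₂) = gSecond τ η x₁ (x₂ + 1 + a) / gSecond τ η x₁ (x₂ + 1 - a) := by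
  have e : exp (-2 * Real.pi * I * a * η * x₁) =
      exp (-Real.pi * I * η * (x₁ * (x₂ + 1 + a))) /
        exp (-Real.pi * I * η * (x₁ * (x₂ + 1 - a))) := by
    rw [← exp_sub]
    ring_nf
  rw [phi, e, gSecond, gSecond, div_div_div_comm, mul_div_mul_comm,
    div_eq_mul_inv _ (gam τ η _ / gam τ η _), inv_div]
  dsimp only
  ring_nf

theorem gFirst_add_two (hτ : 0 < τ.im) (hη : 0 < η.im) {x₂ y : ℂ} (hy : gFirst τ η x₂ y ≠ 0) :
    gFirst τ η x₂ (y + 2) = ((thetaConst τ)⁻¹ ^ 2 * (gaussConst τ η)⁻¹) *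
      (ellNum τ η (y / 2 - x₂ / 2) * (gaussConst τ η * ellNum τ η (y / 2 + x₂ / 2))) *
        gFirst τ η x₂ y := by
  have h1 := right_ne_zero_of_mul (left_ne_zero_of_mul hy)
  have h2 := right_ne_zero_of_mul hy
  have e : exp (-Real.pi * I * η * ((y + 2) ^ 2 / 2 - (y + 2))) *
      (exp (Real.pi * I * η * (y + x₂)) * exp (Real.pi * I * η * (y - x₂))) =
      exp (-Real.pi * I * η * (y ^ 2 / 2 - y)) := by
    rw [← exp_add, ← exp_add]
    ring_nf
  have hL := mul_inv_cancel₀ (gaussConst_ne_zero (η := η) hτ)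
  rw [gFirst, show y + 2 + x₂ = y + x₂ + 2 by ring, show y + 2 - x₂ = y - x₂ + 2 by ring,
    gam_add_two hτ hη h1, gam_add_two hτ hη h2, gFirst, add_div, sub_div]
  generalize exp (-Real.pi * I * η * (y ^ 2 / 2 - y)) = E at e ⊢
  linear_combination ((thetaConst τ)⁻¹ ^ 2 * ellNum τ η (y / 2 + x₂ / 2) *
    ellNum τ η (y / 2 - x₂ / 2) * gam τ η (y + x₂) * gam τ η (y - x₂)) * (e - E * hL)

theorem gSecond_add_two (hτ : 0 < τ.im) (hη : 0 < η.im) {x₁ y : ℂ}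
    (hy : gSecond τ η x₁ y ≠ 0) (hy' : gSecond τ η x₁ (y + 2) ≠ 0) :
    gSecond τ η x₁ (y + 2) = (-(thetaConst τ)⁻¹ ^ 2 * (gaussConst τ η)⁻¹) *
      (ellNum τ η (y / 2 - x₁ / 2) * (gaussConst τ η * ellNum τ η (y / 2 + x₁ / 2))) *
        gSecond τ η x₁ y := by
  have h1 := right_ne_zero_of_mul (div_ne_zero_iff.1 hy).1
  have h2 := (div_ne_zero_iff.1 hy').2
  have h3 := (div_ne_zero_iff.1 hy).2
  rw [show x₁ + 2 - (y + 2) = x₁ - y by ring] at h2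
  have e : exp (-Real.pi * I * η * (x₁ * (y + 2))) *
      (exp (Real.pi * I * η * (x₁ + y)) * exp (Real.pi * I * η * (x₁ - y))) =
      exp (-Real.pi * I * η * (x₁ * y)) := by
    rw [← exp_add, ← exp_add]
    ring_nf
  have hL := mul_inv_cancel₀ (gaussConst_ne_zero (η := η) hτ)
  have hn : ellNum τ η ((x₁ - y) / 2) = -ellNum τ η (y / 2 - x₁ / 2) := by
    rw [ellNum, show 2 * η * ((x₁ - y) / 2) = -(2 * η * (y / 2 - x₁ / 2)) by ring, theta₁_neg]
    rfl
  have h4 := gam_add_two hτ hη h2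
  rw [hn] at h4
  rw [gSecond, gSecond, show x₁ + 2 - (y + 2) = x₁ - y by ring, ← add_assoc,
    gam_add_two hτ hη h1, show (x₁ + y) / 2 = y / 2 + x₁ / 2 by ring]
  rw [show x₁ + 2 - y = x₁ - y + 2 by ring] at h3 ⊢
  rw [← mul_div_assoc, div_eq_div_iff h2 h3, h4]
  generalize exp (-Real.pi * I * η * (x₁ * y)) = E at e ⊢
  linear_combination (-(thetaConst τ)⁻¹ ^ 2 * ellNum τ η (y / 2 + x₁ / 2) *
    ellNum τ η (y / 2 - x₁ / 2) * gam τ η (x₁ + y) * gam τ η (x₁ - y)) * (e - E * hL)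

theorem rising_const_mul (L : ℂ) (f : ℂ → ℂ) (x : ℂ) (n : ℕ) :
    rising (fun x => L * f x) x n = L ^ n * rising f x n := by
  rw [rising, prod_mul_distrib, prod_const, card_range, rising]

/-- The prefactor of the intertwining operator is `W(z) / W(z + a)`, and the very-well-poised
coefficient, with its brackets written by ratios of values of `W`, completes it to a weight. -/
theorem intertwinerCoeff_eq_weight (hτ : 0 < τ.im) (hη : 0 < η.im)
    (hk : ∀ k : ℕ, 1 ≤ k → ellNum τ η (k : ℂ) ≠ 0) (a z : ℂ) (k : ℕ)
    (h0 : ∀ l : ℤ, l.natAbs ≤ k + 1 → gaussGam τ η (z + l) ≠ 0)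
    (h1 : ∀ l : ℤ, l.natAbs ≤ k + 1 → gaussGam τ η (z + a + l) ≠ 0) :
    intertwinerCoeff τ η a k z =
      weight (ellNum τ η) (fun x => gaussConst τ η * ellNum τ η x) (gaussGam τ η) k a z := by
  have hB := brackets_ellNum η (gaussConst τ η) hτ hk
  have hW : ∀ x, gaussGam τ η x ≠ 0 → gaussGam τ η (x + 1) ≠ 0 →
      gaussGam τ η (x + 1) = gaussConst τ η * ellNum τ η x * gaussGam τ η x :=
    fun x hx _ => gaussGam_add_one hτ hη hx
  have hL := gaussConst_ne_zero (η := η) hτ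
  have w0 : gaussGam τ η z ≠ 0 := by simpa using h0 0 (by simp)
  have w1 : gaussGam τ η (z + a) ≠ 0 := by simpa using h1 0 (by simp)
  have w2 : gaussGam τ η (z + a + 1) ≠ 0 := by simpa using h1 1 (by simp)
  have w3 : gaussGam τ η (z - k) ≠ 0 := by
    have := h0 (-k) (by omega)
    push_cast at this
    rwa [← sub_eq_add_neg] at this
  have w4 : gaussGam τ η (z + a - k + 1) ≠ 0 := by
    have := h1 (-k + 1) (by omega)
    push_cast at this
    convert this using 2; ring
  have R1 := rising_eq_div hW (z - k) k fun l hl => by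
    have := h0 (-k + l) (by omega)
    push_cast at this
    convert this using 2; ring
  have R2 := rising_eq_div hW (z + a - k + 1) k fun l hl => by
    have := h1 (-k + 1 + l) (by omega)
    push_cast at this
    convert this using 2; ring
  have C1 := hW _ w1 w2
  have n1 : ellNum τ η (-z - a) = -ellNum τ η (z + a) := by
    rw [← hB.neg]; ring_nf
  have n2 : ellNum τ η (-z - a + 2 * k) = -ellNum τ η (z + a - 2 * k) := by
    rw [← hB.neg]; ring_nf
  have P1 := hB.rising_neg (z - 1) k
  have P2 := hB.rising_neg (z + a) k
  rw [show 1 + (z - 1) - k = z - k by ring, show -(z - 1) = -z + 1 by ring] at P1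
  rw [show 1 + (z + a) - k = z + a - k + 1 by ring, show -(z + a) = -z - a by ring] at P2
  rw [rising_const_mul, P1, sub_add_cancel, eq_div_iff w3] at R1
  rw [rising_const_mul, P2, show z + a - k + 1 + k = z + a + 1 by ring, eq_div_iff w4, C1] at R2
  have hsgn : (-1 : ℂ) ^ k ≠ 0 := pow_ne_zero _ (by norm_num)
  have hLk : gaussConst τ η ^ k ≠ 0 := pow_ne_zero _ hL
  have e1 : rising (ellNum τ η) (-z + 1) k ≠ 0 := fun e => w0 (by rw [← R1, e]; ring)
  have e2 : ellNum τ η (z + a) ≠ 0 := fun e => w2 (by rw [C1, e]; ring)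
  have e3 := hB.rising_one_ne_zero k
  have hexp : exp (2 * Real.pi * I * a * η * z + Real.pi * I * η * a ^ 2) *
      (gam τ η (2 * z) / gam τ η (2 * z + 2 * a)) = gaussGam τ η z / gaussGam τ η (z + a) := by
    rw [gaussGam, gaussGam, mul_div_mul_comm, ← exp_sub, mul_comm]
    ring_nf
  have hp : ∀ x, ellPoch τ η x k = rising (ellNum τ η) x k := fun _ => rfl
  rw [intertwinerCoeff, weight, hexp, hp, hp, hp, hp, n1, n2]
  rw [← R1]
  generalize rising (ellNum τ η) (-z - a) k = A at R2 ⊢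
  generalize rising (ellNum τ η) (-z + 1) k = B at *
  generalize gaussGam τ η (z - k) = W₁ at *
  generalize gaussGam τ η (z + a - k + 1) = W₂ at *
  generalize gaussGam τ η (z + a) = W₃ at *
  field_simp
  linear_combination (ellNum τ η (z + a - 2 * k) * rising (ellNum τ η) (-a) k) * R2

theorem gam_affine_ne_zero (hτ : 0 < τ.im) (hη : 0 < η.im) {α β : ℂ} (hαβ : α ≠ 0 ∨ β ≠ 0)
    (γ : ℂ) : ∀ᶠ x : ℂ × ℂ in generic (ℂ × ℂ), gam τ η (α * x.1 + β * x.2 + γ) ≠ 0 := by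
  filter_upwards [(tendsto_generic_affine hαβ γ).eventually (gam_ne_zero_generic hτ hη)] with x hx
  exact hx

theorem gaussGam_add_ne_zero (hτ : 0 < τ.im) (hη : 0 < η.im) (c : ℂ) :
    ∀ᶠ z in generic ℂ, gaussGam τ η (z + c) ≠ 0 := by
  filter_upwards [(tendsto_generic_affine₁ two_ne_zero (2 * c)).eventually
    (gam_ne_zero_generic hτ hη)] with z hz
  rw [← mul_add] at hz
  exact mul_ne_zero hz (exp_ne_zero _)

theorem gFirst_ne_zero (hτ : 0 < τ.im) (hη : 0 < η.im) (c : ℂ) :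
    ∀ᶠ x : ℂ × ℂ in generic (ℂ × ℂ), gFirst τ η x.2 (x.1 + c) ≠ 0 := by
  filter_upwards [gam_affine_ne_zero hτ hη (α := 1) (β := 1) (by simp) c,
    gam_affine_ne_zero hτ hη (α := 1) (β := -1) (by simp) c] with x h1 h2
  refine mul_ne_zero (mul_ne_zero (exp_ne_zero _) ?_) ?_
  · convert h1 using 2; ring
  · convert h2 using 2; ring

theorem gSecond_ne_zero (hτ : 0 < τ.im) (hη : 0 < η.im) (c : ℂ) :
    ∀ᶠ x : ℂ × ℂ in generic (ℂ × ℂ), gSecond τ η x.2 (x.1 + c) ≠ 0 := by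
  filter_upwards [gam_affine_ne_zero hτ hη (α := 1) (β := 1) (by simp) c,
    gam_affine_ne_zero hτ hη (α := -1) (β := 1) (by simp) (2 - c)] with x h1 h2
  refine div_ne_zero (mul_ne_zero (exp_ne_zero _) ?_) ?_
  · convert h1 using 2; ring
  · convert h2 using 2; ring

theorem coxeterRelations (hτ : 0 < τ.im) (hη : 0 < η.im)
    (hk : ∀ k : ℕ, 1 ≤ k → ellNum τ η (k : ℂ) ≠ 0) :
    CoxeterRelations (S₁ τ η) (S₂ τ η) (S₃ τ η) := by
  have hB := brackets_ellNum η (gaussConst τ η) hτ hk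
  have hW : ∀ x, gaussGam τ η x ≠ 0 → gaussGam τ η (x + 1) ≠ 0 →
      gaussGam τ η (x + 1) = gaussConst τ η * ellNum τ η x * gaussGam τ η x :=
    fun x hx _ => gaussGam_add_one hτ hη hx
  have hWgen : ∀ (c : ℂ) (M : ℕ), ∀ᶠ x : ℂ × ℂ in generic (ℂ × ℂ),
      ∀ k : ℤ, k.natAbs ≤ M → gaussGam τ η (x.1 + c + k) ≠ 0 := fun c M =>
    eventually_forall_natAbs_le M fun k => by
      simpa only [add_assoc] using
        tendsto_generic_fst.eventually (gaussGam_add_ne_zero hτ hη (c + k))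
  -- each product of two coefficients in a braid relation is a product of two weights
  have hcoeff : ∀ (a b z : ℂ) (m : ℕ)
      (_ : ∀ k : ℤ, k.natAbs ≤ 2 * m + 1 → gaussGam τ η (z + 0 + k) ≠ 0)
      (_ : ∀ k : ℤ, k.natAbs ≤ 2 * m + 1 → gaussGam τ η (z + a + k) ≠ 0)
      (_ : ∀ k : ℤ, k.natAbs ≤ 2 * m + 1 → gaussGam τ η (z + (a + b) + k) ≠ 0)
      (k : ℕ × ℕ), k.1 + k.2 = m →
      intertwinerCoeff τ η a k.1 z = weight (ellNum τ η) (fun x => gaussConst τ η * ellNum τ η x)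
        (gaussGam τ η) k.1 a z ∧
      intertwinerCoeff τ η b k.2 (z + 1 * a + -2 * k.1) = weight (ellNum τ η)
        (fun x => gaussConst τ η * ellNum τ η x) (gaussGam τ η) k.2 b (z + a - 2 * k.1) ∧
      intertwinerCoeff τ η (a + b) m z = weight (ellNum τ η)
        (fun x => gaussConst τ η * ellNum τ η x) (gaussGam τ η) m (a + b) z := by
    intro a b z m h0 h1 h2 k hkm
    simp only [add_zero] at h0
    refine ⟨?_, ?_, ?_⟩
    · exact intertwinerCoeff_eq_weight hτ hη hk a z k.1 (fun l hl => h0 l (by omega))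
        fun l hl => h1 l (by omega)
    · rw [show z + 1 * a + -2 * k.1 = z + a - 2 * k.1 by ring]
      refine intertwinerCoeff_eq_weight hτ hη hk b _ k.2 (fun l hl => ?_) fun l hl => ?_
      · have := h1 (l - 2 * k.1) (by omega)
        push_cast at this
        convert this using 2; ring
      · have := h2 (l - 2 * k.1) (by omega)
        push_cast at this
        convert this using 2; ring
    · exact intertwinerCoeff_eq_weight hτ hη hk _ z m (fun l hl => h0 l (by omega))
        fun l hl => h2 l (by omega)
  have key := ShiftSeries.coxeterRelations (s := -2) (ε := 1) (c := intertwinerCoeff τ η)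
    (φ := phi τ η) ?_ ?_ ?_ ?_ ?_
  · simp only [one_mul] at key
    exact key
  · filter_upwards [gFirst_ne_zero hτ hη 1] with x hx
    rw [← Prod.mk.eta (p := x), phi_eq_gFirst, add_zero, sub_zero, div_self hx]
  · intro a
    filter_upwards [gFirst_ne_zero hτ hη (1 + a), gFirst_ne_zero hτ hη (1 - a)] with x hx hx'
    rw [← add_assoc] at hx
    rw [← add_sub_assoc] at hx'
    rw [← Prod.mk.eta (p := x), phi_eq_gFirst, phi_eq_gFirst, sub_neg_eq_add, ← sub_eq_add_neg,
      div_mul_div_cancel₀ hx, div_self hx']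
  · intro k
    have := eventually_forall_natAbs_le (k + 1) fun l =>
      gaussGam_add_ne_zero (τ := τ) (η := η) hτ hη (l : ℂ)
    filter_upwards [this] with z hz
    rw [intertwinerCoeff_eq_weight hτ hη hk 0 z k hz (by simpa using hz),
      hB.weight_zero hW k (by simpa using hz 0 (by simp)) (by simpa using hz 1 (by simp))]
  · intro a b m
    have g0 := eventually_forall_le m fun k => gFirst_ne_zero hτ hη (1 + 2 * a + b - 2 * k)
    have g1 := eventually_forall_le m fun k => gFirst_ne_zero hτ hη (1 - b - 2 * k)
    have g2 := eventually_forall_le m fun k => gFirst_ne_zero hτ hη (1 + b - 2 * k)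
    filter_upwards [g0, g1, g2, hWgen 0 (2 * m + 1), hWgen a (2 * m + 1),
      hWgen (a + b) (2 * m + 1)] with x g0 g1 g2 h0 h1 h2
    obtain ⟨x₁, x₂⟩ := x
    have hc := hcoeff a b x₁ m h0 h1 h2
    have key := hB.braid_sum hW (fun y hy _ => gFirst_add_two (x₂ := x₂) hτ hη hy) a b x₁ m
      (by simpa using h0) h1 (by simpa only [add_assoc] using h2)
      (fun k hk => by convert g0 k hk using 2; ring)
      (fun k hk => by convert g1 k hk using 2; ring)
      (fun k hk => by convert g2 k hk using 2; ring)
    rw [(hc (0, m) (zero_add m)).2.2]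
    simp only [phi_eq_gFirst]
    refine Eq.trans (sum_congr rfl fun k hk => ?_) (key.trans ?_)
    · rw [HasAntidiagonal.mem_antidiagonal] at hk
      rw [(hc k hk).1, (hc k hk).2.1]
      ring_nf
    · ring_nf
  · intro a b m
    have g0 := eventually_forall_le m fun k => gSecond_ne_zero hτ hη (1 + 2 * a + b - 2 * k)
    have g1 := eventually_forall_le m fun k => gSecond_ne_zero hτ hη (1 - b - 2 * k)
    have g2 := eventually_forall_le m fun k => gSecond_ne_zero hτ hη (1 + b - 2 * k)
    filter_upwards [g0, g1, g2, hWgen 0 (2 * m + 1), hWgen a (2 * m + 1),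
      hWgen (a + b) (2 * m + 1)] with x g0 g1 g2 h0 h1 h2
    obtain ⟨x₁, x₂⟩ := x
    have hc := hcoeff a b x₁ m h0 h1 h2
    have key := hB.braid_sum hW (fun y hy hy' => gSecond_add_two (x₁ := x₂) hτ hη hy hy') a b x₁ m
      (by simpa using h0) h1 (by simpa only [add_assoc] using h2)
      (fun k hk => by convert g0 k hk using 2; ring)
      (fun k hk => by convert g1 k hk using 2; ring)
      (fun k hk => by convert g2 k hk using 2; ring)
    rw [(hc (0, m) (zero_add m)).2.2]
    simp only [phi_eq_gSecond, Prod.swap]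
    refine Eq.trans (sum_congr rfl fun k hk => ?_) (key.trans ?_)
    · rw [HasAntidiagonal.mem_antidiagonal] at hk
      rw [(hc k hk).1, (hc k hk).2.1]
      ring_nf
    · ring_nf

end Elliptic

end ParamPerm

end

theorem mainTheorem1 :
    ParamPerm.CoxeterRelations
      ParamPerm.Undeformed.S₁ ParamPerm.Undeformed.S₂ ParamPerm.Undeformed.S₃ ∧
    (∀ h : ℂ, h.re < 0 →
      ParamPerm.CoxeterRelations
        (ParamPerm.Quantum.S₁ h) (ParamPerm.Quantum.S₂ h) (ParamPerm.Quantum.S₃ h)) ∧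
    (∀ τ η : ℂ, 0 < τ.im → 0 < η.im →
      (∀ k : ℕ, 1 ≤ k → ParamPerm.Elliptic.ellNum τ η (k : ℂ) ≠ 0) →
      ParamPerm.CoxeterRelations
        (ParamPerm.Elliptic.S₁ τ η) (ParamPerm.Elliptic.S₂ τ η) (ParamPerm.Elliptic.S₃ τ η)) :=
  ⟨ParamPerm.Undeformed.coxeterRelations, fun _ hh => ParamPerm.Quantum.coxeterRelations hh,
    fun _ _ hτ hη hk => ParamPerm.Elliptic.coxeterRelations hτ hη hk⟩
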